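/- Let $R$ be a ring, $\mathcal M_R$ the category of right $R$-modules, $\mathcal C$ a small additive category in which idempotents split, and $F:\mathcal C\to\mathcal M_R$ an additive functor which is a (non-monoidal) fiber functor, i.e.: $F$ is faithful, reflects isomorphisms, and is flat (the category of elements of its underlying set-valued functor is cofiltered); $FC$ is a finitely generated projective right $R$-module for every object $C$; $\mathcal C$ has kernels of all arrows $t$ for which $Ft$ is an epimorphism; and $\mathcal C$ has cokernels of all arrows $t$ for which $Ft$ is von Neumann regular ($Ft\circ v\circ Ft=Ft$ for some $v$), and $F$ preserves these cokernels. Let $\widehat{\mathcal C}=\mathrm{Add}(\mathcal C^{\mathrm{op}},\mathrm{Ab})$ be the category of additive presheaves. To these data one associates: * the left Kan extension $\mathcal F=-\otimes_{\mathcal C}F:\widehat{\mathcal C}\to\mathcal M_R$ of $F$ along the Yoneda embedding; * the $R$-coring $H=G\otimes_{\mathcal C}F$, where $G=\mathrm{Hom}_R(F-,R)$, with comultiplication $g\otimes x\mapsto\sum_i(g\otimes x_i)\otimes_R(f_i\otimes x)$ for $x\in FC$, $g\in GC$, where $x_i\in FC$, $f_i\in GC$ is a finite dual basis of $FC$, and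 with counit $g\otimes x\mapsto g(x)$; * the category $\mathcal M^H$ of right $H$-comodules and its full subcategory $\mathcal M^H_{\mathrm{fgp}}$ of comodules that are finitely generated projective as right $R$-modules; * the comparison functor $\mathcal K:\widehat{\mathcal C}\to\mathcal M^H$, equipping $U\otimes_{\mathcal C}F$ with the coaction $u\otimes x\mapsto\sum_i(u\otimes x_i)\otimes_R(f_i\otimes x)$, its right adjoint $\mathcal L M=\mathcal M^H(k-,M)$, where $kC$ is $FC$ with the coaction $x\mapsto\sum_i x_i\otimes_R(f_i\otimes x)$, and the idempotent monad $\mathbb T=\mathcal L\mathcal K$ on $\widehat{\mathcal C}$ given by $\mathcal K\dashv\mathcal L$; * the additive Grothendieck topology $\mathcal T_F$ on $\mathcal C$: an additive sieve $S$ on $C$ (an additive subfunctor of $\mathcal C(-,C)$) is covering if and only if every $x\in FC$ is of the form $(Fs)(y)$ with $s\in S$ and $y\in F(\mathrm{dom}\,s)$. The following conditions are equivalent: 1. $F$ reflects split epimorphisms: if $Ft$ is a split epimorphism, then so is $t$. 2. $\mathcal T_F$ is the coarsest Grothendieck topology on $\mathcal C$ (the only covering sieve of each object is the maximal one), i.e.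 $F$ is a coarse fiber functor. 3. $\mathcal K$ is an equivalence of categories. 4. $\mathcal F$ is comonadic. 5. $\mathcal F$ is faithful. 6. $\mathbb T$ is isomorphic, as a monad, to the identity monad on $\widehat{\mathcal C}$. 7. $M\mapsto\mathcal M^H(-,M)$ is an equivalence from $\mathcal M^H$ to the category of additive presheaves of abelian groups on $\mathcal M^H_{\mathrm{fgp}}$, i.e. $H$ is a coarse coring. -/

import Mathlib

open CategoryTheory CategoryTheory.Limits MulOpposite
open scoped TensorProduct

universe u

namespace CoarseFiber

noncomputable section

/-! Throughout, right `R`-modules are modules over `Rᵐᵒᵖ`, so that `m · r` is `op r • m`. -/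

/-! ### The tensor product over a noncommutative ring -/

section BTensor

variable (R : Type u) [Ring R]

/-- The relations `(m · r) ⊗ n = m ⊗ (r · n)` imposed on the tensor product over `ℤ`. -/
def balancedRelations (M N : Type u) [AddCommGroup M] [Module Rᵐᵒᵖ M] [AddCommGroup N]
    [Module R N] : AddSubgroup (M ⊗[ℤ] N) :=
  AddSubgroup.closure {z | ∃ (m : M) (r : R) (n : N), z = (op r • m) ⊗ₜ[ℤ] n - m ⊗ₜ[ℤ] (r • n)}

/-- The tensor product `M ⊗_R N` of a right `R`-module `M` and a left `R`-module `N`. -/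
def BTensor (M N : Type u) [AddCommGroup M] [Module Rᵐᵒᵖ M] [AddCommGroup N]
    [Module R N] : Type u :=
  (M ⊗[ℤ] N) ⧸ balancedRelations R M N

namespace BTensor

section Group

variable {M N : Type u} [AddCommGroup M] [Module Rᵐᵒᵖ M] [AddCommGroup N] [Module R N]

instance : AddCommGroup (BTensor R M N) :=
  inferInstanceAs (AddCommGroup ((M ⊗[ℤ] N) ⧸ balancedRelations R M N))

/-- The projection from the tensor product over `ℤ`. -/
def proj : M ⊗[ℤ] N →+ BTensor R M N :=
  QuotientAddGroup.mk' (balancedRelations R M N)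

/-- The pure tensor `m ⊗ n`. -/
def tmul (m : M) (n : N) : BTensor R M N :=
  proj R (m ⊗ₜ[ℤ] n)

lemma tmul_add (m : M) (n n' : N) : tmul R m (n + n') = tmul R m n + tmul R m n' := by
  simp only [tmul, TensorProduct.tmul_add, map_add]

lemma add_tmul (m m' : M) (n : N) : tmul R (m + m') n = tmul R m n + tmul R m' n := by
  simp only [tmul, TensorProduct.add_tmul, map_add]

lemma op_smul_tmul (r : R) (m : M) (n : N) : tmul R (op r • m) n = tmul R m (r • n) := by
  rw [← sub_eq_zero, tmul, tmul, ← map_sub (proj R (M := M) (N := N))]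
  exact (QuotientAddGroup.eq_zero_iff _).2 (AddSubgroup.subset_closure ⟨m, r, n, rfl⟩)

/-- `m ↦ m ⊗ n` as an additive map. -/
def tmulLeft (n : N) : M →+ BTensor R M N :=
  AddMonoidHom.mk' (fun m => tmul R m n) (fun m m' => add_tmul R m m' n)

/-- `n ↦ m ⊗ n` as an additive map. -/
def tmulRight (m : M) : N →+ BTensor R M N :=
  AddMonoidHom.mk' (fun n => tmul R m n) (fun n n' => tmul_add R m n n')

lemma zero_tmul (n : N) : tmul R (0 : M) n = 0 := (tmulLeft R n).map_zero

lemma tmul_zero (m : M) : tmul R m (0 : N) = 0 := (tmulRight R m).map_zero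

lemma sum_tmul {ι : Type*} (s : Finset ι) (f : ι → M) (n : N) :
    tmul R (∑ i ∈ s, f i) n = ∑ i ∈ s, tmul R (f i) n :=
  map_sum (tmulLeft R n) f s

lemma tmul_sum {ι : Type*} (s : Finset ι) (m : M) (f : ι → N) :
    tmul R m (∑ i ∈ s, f i) = ∑ i ∈ s, tmul R m (f i) :=
  map_sum (tmulRight R m) f s

variable {R}

/-- The additive map out of `M ⊗_R N` induced by a balanced biadditive map. -/
def lift {P : Type u} [AddCommGroup P] (f : M →+ N →+ P)
    (hf : ∀ (r : R) (m : M) (n : N), f (op r • m) n = f m (r • n)) : BTensor R M N →+ P :=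
  QuotientAddGroup.lift (balancedRelations R M N)
    (TensorProduct.liftAddHom f (fun k m n => by simp)) (by
      rw [balancedRelations, AddSubgroup.closure_le]
      rintro _ ⟨m, r, n, rfl⟩
      simp [hf])

@[simp] lemma lift_tmul {P : Type u} [AddCommGroup P] (f : M →+ N →+ P)
    (hf : ∀ (r : R) (m : M) (n : N), f (op r • m) n = f m (r • n)) (m : M) (n : N) :
    lift f hf (tmul R m n) = f m n := rfl

lemma hom_ext {P : Type u} [AddCommGroup P] {f g : BTensor R M N →+ P}
    (h : ∀ m n, f (tmul R m n) = g (tmul R m n)) : f = g := by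
  apply QuotientAddGroup.addMonoidHom_ext
  ext z
  induction z using TensorProduct.induction_on with
  | zero => simp
  | tmul m n => exact h m n
  | add a b ha hb => simp only [map_add, ha, hb]

lemma hom_congr {P : Type u} [AddCommGroup P] (f g : BTensor R M N →+ P)
    (h : ∀ m n, f (tmul R m n) = g (tmul R m n)) (z : BTensor R M N) : f z = g z :=
  DFunLike.congr_fun (hom_ext h) z

end Group

section Functoriality

variable {R}
variable {M M' N N' : Type u} [AddCommGroup M] [Module Rᵐᵒᵖ M] [AddCommGroup N] [Module R N]
  [AddCommGroup M'] [Module Rᵐᵒᵖ M'] [AddCommGroup N'] [Module R N']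

/-- `f ⊗ N` for a homomorphism `f` of right modules. -/
def rTensor (f : M →+ M') (hf : ∀ (r : R) (m : M), f (op r • m) = op r • f m) :
    BTensor R M N →+ BTensor R M' N :=
  lift (AddMonoidHom.mk' (fun m => tmulRight R (f m))
    (fun m m' => by ext n; simp [tmulRight, add_tmul]))
    (fun r m n => by simp [tmulRight, hf, op_smul_tmul])

/-- `M ⊗ g` for a homomorphism `g` of left modules. -/
def lTensor (g : N →+ N') (hg : ∀ (r : R) (n : N), g (r • n) = r • g n) :
    BTensor R M N →+ BTensor R M N' :=
  lift (AddMonoidHom.mk' (fun m => (tmulRight R m).comp g)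
    (fun m m' => by ext n; simp [tmulRight, add_tmul]))
    (fun r m n => by simp [tmulRight, hg, op_smul_tmul])

@[simp] lemma rTensor_tmul (f : M →+ M') (hf : ∀ (r : R) (m : M), f (op r • m) = op r • f m)
    (m : M) (n : N) : rTensor f hf (tmul R m n) = tmul R (f m) n := rfl

@[simp] lemma lTensor_tmul (g : N →+ N') (hg : ∀ (r : R) (n : N), g (r • n) = r • g n)
    (m : M) (n : N) : lTensor g hg (tmul R m n) = tmul R m (g n) := rfl

end Functoriality

section Modules

variable {R}
variable {M N : Type u} [AddCommGroup M] [Module Rᵐᵒᵖ M] [AddCommGroup N] [Module R N]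

/-- The right action of `r` on `M ⊗_R N` for a bimodule `N`. -/
def actRight [Module Rᵐᵒᵖ N] [SMulCommClass R Rᵐᵒᵖ N] (r : Rᵐᵒᵖ) :
    BTensor R M N →+ BTensor R M N :=
  lTensor (DistribSMul.toAddMonoidHom N r) (by intro s n; simpa using (smul_comm s r n).symm)

lemma actRight_tmul [Module Rᵐᵒᵖ N] [SMulCommClass R Rᵐᵒᵖ N] (r : Rᵐᵒᵖ) (m : M) (n : N) :
    actRight r (tmul R m n) = tmul R m (r • n) := rfl

/-- `M ⊗_R N` is a right `R`-module if `N` is a bimodule: `(m ⊗ n) · r = m ⊗ (n · r)`. -/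
instance rightModule [Module Rᵐᵒᵖ N] [SMulCommClass R Rᵐᵒᵖ N] : Module Rᵐᵒᵖ (BTensor R M N) where
  smul r z := actRight r z
  one_smul z := hom_congr (actRight 1) (AddMonoidHom.id _)
    (fun m n => by simp [actRight_tmul]) z
  mul_smul r s z := hom_congr (actRight (r * s)) ((actRight r).comp (actRight s))
    (fun m n => by simp [actRight_tmul, mul_smul]) z
  smul_zero r := map_zero _
  smul_add r := map_add _
  add_smul r s z := hom_congr (actRight (r + s)) (actRight r + actRight s)
    (fun m n => by simp [actRight_tmul, add_smul, tmul_add]) z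
  zero_smul z := hom_congr (actRight 0) 0
    (fun m n => by simp [actRight_tmul, tmul_zero]) z

@[simp] lemma smul_tmul_right [Module Rᵐᵒᵖ N] [SMulCommClass R Rᵐᵒᵖ N] (r : Rᵐᵒᵖ) (m : M) (n : N) :
    r • tmul R m n = tmul R m (r • n) := rfl

/-- The left action of `r` on `M ⊗_R N` for a bimodule `M`. -/
def actLeft [Module R M] [SMulCommClass R Rᵐᵒᵖ M] (r : R) :
    BTensor R M N →+ BTensor R M N :=
  rTensor (DistribSMul.toAddMonoidHom M r) (by intro s m; simpa using smul_comm r (op s) m)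

lemma actLeft_tmul [Module R M] [SMulCommClass R Rᵐᵒᵖ M] (r : R) (m : M) (n : N) :
    actLeft r (tmul R m n) = tmul R (r • m) n := rfl

/-- `M ⊗_R N` is a left `R`-module if `M` is a bimodule: `r · (m ⊗ n) = (r · m) ⊗ n`. -/
instance leftModule [Module R M] [SMulCommClass R Rᵐᵒᵖ M] : Module R (BTensor R M N) where
  smul r z := actLeft r z
  one_smul z := hom_congr (actLeft 1) (AddMonoidHom.id _)
    (fun m n => by simp [actLeft_tmul]) z
  mul_smul r s z := hom_congr (actLeft (r * s)) ((actLeft r).comp (actLeft s))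
    (fun m n => by simp [actLeft_tmul, mul_smul]) z
  smul_zero r := map_zero _
  smul_add r := map_add _
  add_smul r s z := hom_congr (actLeft (r + s)) (actLeft r + actLeft s)
    (fun m n => by simp [actLeft_tmul, add_smul, add_tmul]) z
  zero_smul z := hom_congr (actLeft 0) 0
    (fun m n => by simp [actLeft_tmul, zero_tmul]) z

@[simp] lemma smul_tmul_left [Module R M] [SMulCommClass R Rᵐᵒᵖ M] (r : R) (m : M) (n : N) :
    r • tmul R m n = tmul R (r • m) n := rfl

instance [Module R M] [SMulCommClass R Rᵐᵒᵖ M] [Module Rᵐᵒᵖ N] [SMulCommClass R Rᵐᵒᵖ N] :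
    SMulCommClass R Rᵐᵒᵖ (BTensor R M N) where
  smul_comm r s z := hom_congr
    ((DistribSMul.toAddMonoidHom (BTensor R M N) r).comp (DistribSMul.toAddMonoidHom _ s))
    ((DistribSMul.toAddMonoidHom (BTensor R M N) s).comp (DistribSMul.toAddMonoidHom _ r))
    (fun m n => by simp) z

/-- The canonical map `M ⊗_R R → M`, `m ⊗ r ↦ m · r`. -/
def rid : BTensor R M R →+ M :=
  lift (AddMonoidHom.mk' (fun m => AddMonoidHom.mk' (fun r : R => op r • m)
    (fun r s => by simp [add_smul])) (fun m m' => by ext r; simp))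
    (fun r m s => by simp [mul_smul])

@[simp] lemma rid_tmul (m : M) (r : R) : rid (tmul R m r) = op r • m := rfl

/-- The canonical map `R ⊗_R N → N`, `r ⊗ n ↦ r · n`. -/
def lid : BTensor R R N →+ N :=
  lift (AddMonoidHom.mk' (fun r : R => DistribSMul.toAddMonoidHom N r)
    (fun r s => by ext n; simp [add_smul]))
    (fun r s n => by simp [mul_smul])

@[simp] lemma lid_tmul (r : R) (n : N) : lid (tmul R r n) = r • n := rfl

variable {P : Type u} [AddCommGroup P] [Module R P] [Module Rᵐᵒᵖ N] [SMulCommClass R Rᵐᵒᵖ N]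

/-- The canonical map `M ⊗_R (N ⊗_R P) → (M ⊗_R N) ⊗_R P`, `m ⊗ (n ⊗ p) ↦ (m ⊗ n) ⊗ p`. -/
def assocInv : BTensor R M (BTensor R N P) →+ BTensor R (BTensor R M N) P :=
  lift (AddMonoidHom.mk' (fun m => rTensor (tmulRight R m) (fun r n => rfl))
    (fun m m' => hom_ext (fun n p => by simp [tmulRight, add_tmul])))
    (fun r m z => hom_congr (rTensor (tmulRight R (op r • m)) (fun r n => rfl))
      ((rTensor (tmulRight R m) (fun r n => rfl)).comp
        (DistribSMul.toAddMonoidHom (BTensor R N P) r))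
      (fun n p => by simp [tmulRight, op_smul_tmul]) z)

@[simp] lemma assocInv_tmul (m : M) (n : N) (p : P) :
    assocInv (tmul R m (tmul R n p)) = tmul R (tmul R m n) p := rfl

end Modules

end BTensor

end BTensor

/-! ### Corings and their comodules -/

open BTensor in
/-- An `R`-coring: a comonoid in the monoidal category of `R`-`R`-bimodules. -/
structure Coring (R : Type u) [Ring R] where
  /-- The underlying bimodule. -/
  carrier : Type u
  [addCommGroup : AddCommGroup carrier]
  [leftModule : Module R carrier]
  [rightModule : Module Rᵐᵒᵖ carrier]
  [smulCommClass : SMulCommClass R Rᵐᵒᵖ carrier]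
  /-- The comultiplication. -/
  comul : carrier →+ BTensor R carrier carrier
  comul_smul : ∀ (r : R) (h : carrier), comul (r • h) = r • comul h
  comul_op_smul : ∀ (r : R) (h : carrier), comul (op r • h) = op r • comul h
  /-- The counit. -/
  counit : carrier →+ R
  counit_smul : ∀ (r : R) (h : carrier), counit (r • h) = r • counit h
  counit_op_smul : ∀ (r : R) (h : carrier), counit (op r • h) = op r • counit h
  coassoc : ∀ h : carrier,
    assocInv (lTensor comul comul_smul (comul h)) = rTensor comul comul_op_smul (comul h)
  lid_counit : ∀ h : carrier, lid (rTensor counit counit_op_smul (comul h)) = h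
  rid_counit : ∀ h : carrier, rid (lTensor counit counit_smul (comul h)) = h

namespace Coring

attribute [instance] Coring.addCommGroup Coring.leftModule Coring.rightModule Coring.smulCommClass

variable {R : Type u} [Ring R] (H : Coring R)

open BTensor

lemma toAddMonoidHom_op_smul {M M' : Type u} [AddCommGroup M] [Module Rᵐᵒᵖ M] [AddCommGroup M']
    [Module Rᵐᵒᵖ M'] (f : M →ₗ[Rᵐᵒᵖ] M') (r : R) (m : M) :
    f.toAddMonoidHom (op r • m) = op r • f.toAddMonoidHom m := f.map_smul (op r) m

/-- The homomorphism `f ⊗ H` of right modules. -/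
def tensorMap {M M' : Type u} [AddCommGroup M] [Module Rᵐᵒᵖ M] [AddCommGroup M'] [Module Rᵐᵒᵖ M']
    (f : M →ₗ[Rᵐᵒᵖ] M') : BTensor R M H.carrier →ₗ[Rᵐᵒᵖ] BTensor R M' H.carrier where
  toFun := rTensor f.toAddMonoidHom (toAddMonoidHom_op_smul f)
  map_add' := map_add _
  map_smul' r z := hom_congr
    ((rTensor f.toAddMonoidHom (toAddMonoidHom_op_smul f)).comp (actRight r))
    ((actRight r).comp (rTensor f.toAddMonoidHom (toAddMonoidHom_op_smul f)))
    (fun m h => by simp [actRight_tmul]) z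

@[simp] lemma tensorMap_tmul {M M' : Type u} [AddCommGroup M] [Module Rᵐᵒᵖ M] [AddCommGroup M']
    [Module Rᵐᵒᵖ M'] (f : M →ₗ[Rᵐᵒᵖ] M') (m : M) (h : H.carrier) :
    H.tensorMap f (tmul R m h) = tmul R (f m) h := rfl

/-- Linear maps out of `M ⊗_R H` are determined by pure tensors. -/
lemma linear_ext {M P : Type u} [AddCommGroup M] [Module Rᵐᵒᵖ M] [AddCommGroup P] [Module Rᵐᵒᵖ P]
    {f g : BTensor R M H.carrier →ₗ[Rᵐᵒᵖ] P} (e : ∀ m h, f (tmul R m h) = g (tmul R m h)) :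
    f = g :=
  LinearMap.ext (hom_congr f.toAddMonoidHom g.toAddMonoidHom e)

/-- The functor `M ↦ M ⊗_R H` on right `R`-modules. -/
def tensorFunctor : ModuleCat.{u} Rᵐᵒᵖ ⥤ ModuleCat.{u} Rᵐᵒᵖ where
  obj M := ModuleCat.of Rᵐᵒᵖ (BTensor R M H.carrier)
  map f := ModuleCat.ofHom (H.tensorMap f.hom)
  map_id M := ModuleCat.hom_ext (H.linear_ext fun m h => by simp)
  map_comp f g := ModuleCat.hom_ext (H.linear_ext fun m h => by simp)

instance : H.tensorFunctor.Additive where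
  map_add {M M' f g} := ModuleCat.hom_ext (H.linear_ext fun m h => by
    change H.tensorMap (f.hom + g.hom) (tmul R m h) =
      H.tensorMap f.hom (tmul R m h) + H.tensorMap g.hom (tmul R m h)
    simp [add_tmul])

/-- The homomorphism `M ⊗_R ε : M ⊗_R H → M`. -/
def counitMap (M : Type u) [AddCommGroup M] [Module Rᵐᵒᵖ M] :
    BTensor R M H.carrier →ₗ[Rᵐᵒᵖ] M where
  toFun z := rid (lTensor H.counit H.counit_smul z)
  map_add' := by simp
  map_smul' r z := hom_congr
    ((rid.comp (lTensor H.counit H.counit_smul)).comp (actRight r))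
    ((DistribSMul.toAddMonoidHom M r).comp (rid.comp (lTensor H.counit H.counit_smul)))
    (fun m h => by
      induction r using MulOpposite.rec' with
      | h r => simp [actRight_tmul, H.counit_op_smul, mul_smul]) z

@[simp] lemma counitMap_tmul {M : Type u} [AddCommGroup M] [Module Rᵐᵒᵖ M] (m : M)
    (h : H.carrier) : H.counitMap M (tmul R m h) = op (H.counit h) • m := rfl

/-- The homomorphism `m ⊗ n ↦ (x ⊗ m) ⊗ n`. -/
def insertMap {M : Type u} [AddCommGroup M] [Module Rᵐᵒᵖ M] (x : M) :
    H.carrier →ₗ[Rᵐᵒᵖ] BTensor R M H.carrier where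
  toFun h := tmul R x h
  map_add' := tmul_add R x
  map_smul' _ _ := rfl

@[simp] lemma insertMap_apply {M : Type u} [AddCommGroup M] [Module Rᵐᵒᵖ M] (x : M)
    (h : H.carrier) : H.insertMap x h = tmul R x h := rfl

/-- The homomorphism `M ⊗_R Δ : M ⊗_R H → M ⊗_R (H ⊗_R H)`, its target being identified with
`(M ⊗_R H) ⊗_R H`. -/
def comulMap (M : Type u) [AddCommGroup M] [Module Rᵐᵒᵖ M] :
    BTensor R M H.carrier →ₗ[Rᵐᵒᵖ] BTensor R (BTensor R M H.carrier) H.carrier where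
  toFun z := assocInv (lTensor H.comul H.comul_smul z)
  map_add' := by simp
  map_smul' r z := hom_congr
    ((assocInv.comp (lTensor H.comul H.comul_smul)).comp (actRight r))
    ((actRight r).comp (assocInv.comp (lTensor H.comul H.comul_smul)))
    (fun m h => by
      induction r using MulOpposite.rec' with
      | h r => 
        simp only [AddMonoidHom.comp_apply, actRight_tmul, lTensor_tmul, H.comul_op_smul]
        exact (H.tensorMap (H.insertMap m)).map_smul (op r) (H.comul h)) z

lemma comulMap_tmul {M : Type u} [AddCommGroup M] [Module Rᵐᵒᵖ M] (m : M)
    (h : H.carrier) : H.comulMap M (tmul R m h) = H.tensorMap (H.insertMap m) (H.comul h) := rfl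

/-- The comonad `M ↦ M ⊗_R H` on right `R`-modules. -/
def comonad : Comonad (ModuleCat.{u} Rᵐᵒᵖ) where
  toFunctor := H.tensorFunctor
  ε :=
    { app M := ModuleCat.ofHom (H.counitMap M)
      naturality M M' f := ModuleCat.hom_ext (H.linear_ext fun m h => by
        simp [tensorFunctor]) }
  δ :=
    { app M := ModuleCat.ofHom (H.comulMap M)
      naturality M M' f := ModuleCat.hom_ext (H.linear_ext fun m h => by
        change H.comulMap M' (tmul R (f.hom m) h) =
          H.tensorMap (H.tensorMap f.hom) (H.comulMap M (tmul R m h))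
        rw [comulMap_tmul, comulMap_tmul, ← LinearMap.comp_apply]
        congr 1
        exact H.linear_ext fun _ _ => rfl) }
  coassoc M := ModuleCat.hom_ext (H.linear_ext fun m h => by
    change H.tensorMap (H.comulMap M) (H.comulMap M (tmul R m h)) =
      H.comulMap _ (H.comulMap M (tmul R m h))
    rw [comulMap_tmul]
    have e1 := hom_congr
      ((H.tensorMap (H.comulMap M)).toAddMonoidHom.comp
        (H.tensorMap (H.insertMap m)).toAddMonoidHom)
      ((H.tensorMap (H.tensorMap (H.insertMap m))).toAddMonoidHom.comp
        (rTensor H.comul H.comul_op_smul)) (fun a b => rfl) (H.comul h)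
    have e2 := hom_congr
      ((H.comulMap _).toAddMonoidHom.comp (H.tensorMap (H.insertMap m)).toAddMonoidHom)
      ((H.tensorMap (H.tensorMap (H.insertMap m))).toAddMonoidHom.comp
        (assocInv.comp (lTensor H.comul H.comul_smul))) (fun a b => by
          change H.tensorMap (H.insertMap (tmul R m a)) (H.comul b) =
            H.tensorMap (H.tensorMap (H.insertMap m)) (H.tensorMap (H.insertMap a) (H.comul b))
          rw [← LinearMap.comp_apply]
          congr 1
          exact H.linear_ext fun _ _ => rfl) (H.comul h)
    refine e1.trans (Eq.trans ?_ e2.symm)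
    exact congrArg (H.tensorMap (H.tensorMap (H.insertMap m))) (H.coassoc h).symm)
  left_counit M := ModuleCat.hom_ext (H.linear_ext fun m h => by
    change H.counitMap _ (H.comulMap M (tmul R m h)) = tmul R m h
    rw [comulMap_tmul]
    have e := hom_congr
      ((H.counitMap _).toAddMonoidHom.comp (H.tensorMap (H.insertMap m)).toAddMonoidHom)
      ((H.insertMap m).toAddMonoidHom.comp (rid.comp (lTensor H.counit H.counit_smul)))
      (fun a b => rfl) (H.comul h)
    exact e.trans (congrArg (H.insertMap m) (H.rid_counit h)))
  right_counit M := ModuleCat.hom_ext (H.linear_ext fun m h => by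
    change H.tensorMap (H.counitMap M) (H.comulMap M (tmul R m h)) = tmul R m h
    rw [comulMap_tmul]
    have e := hom_congr
      ((H.tensorMap (H.counitMap M)).toAddMonoidHom.comp
        (H.tensorMap (H.insertMap m)).toAddMonoidHom)
      ((H.insertMap m).toAddMonoidHom.comp (lid.comp (rTensor H.counit H.counit_op_smul)))
      (fun a b => op_smul_tmul R (H.counit a) m b) (H.comul h)
    exact e.trans (congrArg (H.insertMap m) (H.lid_counit h)))

instance : (H.comonad : ModuleCat.{u} Rᵐᵒᵖ ⥤ ModuleCat.{u} Rᵐᵒᵖ).Additive :=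
  inferInstanceAs H.tensorFunctor.Additive

/-- The category `𝓜^H` of right `H`-comodules: right `R`-modules `M` with a homomorphism
`M → M ⊗_R H` which is coassociative and counital. -/
abbrev Comodule : Type (u + 1) := H.comonad.Coalgebra

/-- The comodules which are finitely generated and projective as right `R`-modules. -/
def fgpProperty : ObjectProperty H.Comodule :=
  fun M => Module.Finite Rᵐᵒᵖ M.A ∧ Module.Projective Rᵐᵒᵖ M.A

/-- The full subcategory `𝓜^H_fgp` of comodules which are finitely generated and projective as
right `R`-modules. -/
abbrev FGPComodule : Type (u + 1) := H.fgpProperty.FullSubcategory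

end Coring

/-! ### Additive presheaves and the tensor product over a category -/

section Category

/-- For an additive functor `k : D ⥤ A`, the functor `A ⥤ Add(Dᵒᵖ, Ab)` sending `M` to the
presheaf `A(k -, M)`. -/
def restrictedYoneda {D A : Type*} [Category* D] [Preadditive D] [Category.{u} A] [Preadditive A]
    (k : D ⥤ A) [k.Additive] : A ⥤ (Dᵒᵖ ⥤+ AddCommGrpCat.{u}) where
  obj M :=
    ⟨{ obj X := AddCommGrpCat.of (k.obj X.unop ⟶ M)
       map f := AddCommGrpCat.ofHom (Preadditive.leftComp M (k.map f.unop))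
       map_id X := by ext; simp [Preadditive.leftComp]
       map_comp f g := by ext; simp [Preadditive.leftComp] },
     { map_add := by intros; ext; simp [Preadditive.leftComp] }⟩
  map {M N} f := ObjectProperty.homMk
    { app X := AddCommGrpCat.ofHom (Preadditive.rightComp (k.obj X.unop) f)
      naturality X Y g := by ext; simp [Preadditive.leftComp, Preadditive.rightComp] }
  map_id M := by ext; simp [Preadditive.rightComp]
  map_comp f g := by ext; simp [Preadditive.rightComp]

section CTensor

variable {C : Type u} [SmallCategory C] {R : Type u} [Ring R]

variable (U : Cᵒᵖ ⥤ AddCommGrpCat.{u}) (F : C ⥤ ModuleCat.{u} Rᵐᵒᵖ)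

/-- The coproduct of the abelian groups `U X ⊗ F X` over all objects `X`. -/
abbrev PreCTensor : Type u :=
  DirectSum C fun X => (U.obj (Opposite.op X)) ⊗[ℤ] (F.obj X)

open Classical in
/-- The inclusion of the summand `U X ⊗ F X`. -/
def PreCTensor.incl (X : C) : (U.obj (Opposite.op X)) ⊗[ℤ] (F.obj X) →+ PreCTensor U F :=
  DirectSum.of (fun X => (U.obj (Opposite.op X)) ⊗[ℤ] (F.obj X)) X

/-- The relations `U(t)(u) ⊗ x = u ⊗ F(t)(x)`. -/
def cTensorRelations : AddSubgroup (PreCTensor U F) :=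
  AddSubgroup.closure {z | ∃ (X Y : C) (t : X ⟶ Y) (u : U.obj (Opposite.op Y)) (x : F.obj X),
    z = PreCTensor.incl U F X ((U.map t.op u) ⊗ₜ[ℤ] x) -
      PreCTensor.incl U F Y (u ⊗ₜ[ℤ] (F.map t x))}

/-- The tensor product `U ⊗_C F`, that is, the coend of `U ⊗ F`. -/
def CTensor : Type u := PreCTensor U F ⧸ cTensorRelations U F

namespace CTensor

instance : AddCommGroup (CTensor U F) :=
  inferInstanceAs (AddCommGroup (PreCTensor U F ⧸ cTensorRelations U F))

/-- The projection from the coproduct of the groups `U X ⊗ F X`. -/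
def proj : PreCTensor U F →+ CTensor U F :=
  QuotientAddGroup.mk' (cTensorRelations U F)

variable {U F}

/-- The rank one tensor `u ⊗_X x`. -/
def tmul {X : C} (u : U.obj (Opposite.op X)) (x : F.obj X) : CTensor U F :=
  proj U F (PreCTensor.incl U F X (u ⊗ₜ[ℤ] x))

lemma tmul_add {X : C} (u : U.obj (Opposite.op X)) (x x' : F.obj X) :
    tmul u (x + x') = tmul u x + tmul u x' := by
  simp only [tmul, TensorProduct.tmul_add, map_add]

lemma add_tmul {X : C} (u u' : U.obj (Opposite.op X)) (x : F.obj X) :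
    tmul (u + u') x = tmul u x + tmul u' x := by
  simp only [tmul, TensorProduct.add_tmul, map_add]

lemma map_tmul {X Y : C} (t : X ⟶ Y) (u : U.obj (Opposite.op Y)) (x : F.obj X) :
    tmul (U.map t.op u) x = tmul u (F.map t x) := by
  rw [← sub_eq_zero, tmul, tmul, ← map_sub (proj U F)]
  exact (QuotientAddGroup.eq_zero_iff _).2 (AddSubgroup.subset_closure ⟨X, Y, t, u, x, rfl⟩)

/-- `x ↦ u ⊗ x` as an additive map. -/
def tmulRight {X : C} (u : U.obj (Opposite.op X)) : F.obj X →+ CTensor U F :=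
  AddMonoidHom.mk' (fun x => tmul u x) (tmul_add u)

/-- `u ↦ u ⊗ x` as an additive map. -/
def tmulLeft {X : C} (x : F.obj X) : U.obj (Opposite.op X) →+ CTensor U F :=
  AddMonoidHom.mk' (fun u => tmul u x) (fun u u' => add_tmul u u' x)

lemma sum_tmul {X : C} {ι : Type*} (s : Finset ι) (f : ι → U.obj (Opposite.op X)) (x : F.obj X) :
    tmul (∑ i ∈ s, f i) x = ∑ i ∈ s, tmul (f i) x :=
  map_sum (tmulLeft x) f s

lemma tmul_sum {X : C} {ι : Type*} (s : Finset ι) (u : U.obj (Opposite.op X)) (f : ι → F.obj X) :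
    tmul u (∑ i ∈ s, f i) = ∑ i ∈ s, tmul u (f i) :=
  map_sum (tmulRight u) f s

lemma tmul_zero {X : C} (u : U.obj (Opposite.op X)) : tmul u (0 : F.obj X) = 0 :=
  (tmulRight u).map_zero

open Classical in
/-- The additive map out of `U ⊗_C F` induced by a balanced family of biadditive maps. -/
def lift {P : Type u} [AddCommGroup P]
    (f : ∀ X : C, U.obj (Opposite.op X) →+ F.obj X →+ P)
    (hf : ∀ (X Y : C) (t : X ⟶ Y) (u : U.obj (Opposite.op Y)) (x : F.obj X),
      f X (U.map t.op u) x = f Y u (F.map t x)) : CTensor U F →+ P :=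
  QuotientAddGroup.lift (cTensorRelations U F)
    (DirectSum.toAddMonoid fun X => TensorProduct.liftAddHom (f X) (fun k m n => by simp)) (by
      rw [cTensorRelations, AddSubgroup.closure_le]
      rintro _ ⟨X, Y, t, u, x, rfl⟩
      simp [PreCTensor.incl, hf])

open Classical in
@[simp] lemma lift_tmul {P : Type u} [AddCommGroup P]
    (f : ∀ X : C, U.obj (Opposite.op X) →+ F.obj X →+ P)
    (hf : ∀ (X Y : C) (t : X ⟶ Y) (u : U.obj (Opposite.op Y)) (x : F.obj X),
      f X (U.map t.op u) x = f Y u (F.map t x)) {X : C} (u : U.obj (Opposite.op X)) (x : F.obj X) :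
    lift f hf (tmul u x) = f X u x :=
  DirectSum.toAddMonoid_of (fun X => TensorProduct.liftAddHom (f X) (fun k m n => by simp)) X
    (u ⊗ₜ[ℤ] x)

lemma hom_congr {P : Type u} [AddCommGroup P] (f g : CTensor U F →+ P)
    (h : ∀ (X : C) (u : U.obj (Opposite.op X)) (x : F.obj X), f (tmul u x) = g (tmul u x))
    (z : CTensor U F) : f z = g z := by
  classical
  refine DFunLike.congr_fun (QuotientAddGroup.addMonoidHom_ext _ (f := f) (g := g) ?_) z
  refine DirectSum.addHom_ext' fun X => AddMonoidHom.ext fun y => ?_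
  induction y using TensorProduct.induction_on with
  | zero => simp
  | tmul u x => exact h X u x
  | add a b ha hb => simp only [map_add, ha, hb]

/-- The action of `r` on `U ⊗_C F`. -/
def act (r : Rᵐᵒᵖ) : CTensor U F →+ CTensor U F :=
  lift (fun X => AddMonoidHom.mk'
      (fun u => (tmulRight u).comp (DistribSMul.toAddMonoidHom (F.obj X) r))
      (fun u u' => by ext x; simp [tmulRight, add_tmul]))
    (fun X Y t u x => by simp [tmulRight, map_tmul])

@[simp] lemma act_tmul (r : Rᵐᵒᵖ) {X : C} (u : U.obj (Opposite.op X)) (x : F.obj X) :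
    act r (tmul u x) = tmul u (r • x) := lift_tmul _ _ u x

/-- `U ⊗_C F` is a right `R`-module by `(u ⊗ x) · r = u ⊗ (x · r)`. -/
instance : Module Rᵐᵒᵖ (CTensor U F) where
  smul r z := act r z
  one_smul z := hom_congr (act 1) (AddMonoidHom.id _) (fun X u x => by simp) z
  mul_smul r s z := hom_congr (act (r * s)) ((act r).comp (act s))
    (fun X u x => by simp [mul_smul]) z
  smul_zero r := map_zero _
  smul_add r := map_add _
  add_smul r s z := hom_congr (act (r + s)) (act r + act s)
    (fun X u x => by simp [add_smul, tmul_add]) z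
  zero_smul z := hom_congr (act 0) 0 (fun X u x => by simp [tmul_zero]) z

lemma smul_def (r : Rᵐᵒᵖ) (z : CTensor U F) : r • z = act r z := rfl

@[simp] lemma smul_tmul (r : Rᵐᵒᵖ) {X : C} (u : U.obj (Opposite.op X)) (x : F.obj X) :
    r • tmul u x = tmul u (r • x) := act_tmul r u x

/-- Linear maps out of `U ⊗_C F` are determined by rank one tensors. -/
lemma linear_ext {P : Type u} [AddCommGroup P] [Module Rᵐᵒᵖ P] {f g : CTensor U F →ₗ[Rᵐᵒᵖ] P}
    (h : ∀ (X : C) (u : U.obj (Opposite.op X)) (x : F.obj X), f (tmul u x) = g (tmul u x)) :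
    f = g :=
  LinearMap.ext (hom_congr f.toAddMonoidHom g.toAddMonoidHom h)

/-- A biadditive map which is linear in the second variable, as a biadditive map. -/
def forgetLinear {A M P : Type u} [AddCommGroup A] [AddCommGroup M] [Module Rᵐᵒᵖ M]
    [AddCommGroup P] [Module Rᵐᵒᵖ P] (f : A →+ (M →ₗ[Rᵐᵒᵖ] P)) : A →+ M →+ P :=
  AddMonoidHom.mk' (fun u => (f u).toAddMonoidHom) (fun u u' => by ext x; simp)

@[simp] lemma forgetLinear_apply {A M P : Type u} [AddCommGroup A] [AddCommGroup M]
    [Module Rᵐᵒᵖ M] [AddCommGroup P] [Module Rᵐᵒᵖ P] (f : A →+ (M →ₗ[Rᵐᵒᵖ] P)) (u : A) (x : M) :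
    forgetLinear f u x = f u x := rfl

/-- The linear map out of `U ⊗_C F` induced by a balanced family of biadditive maps which are
linear in the second variable. -/
def liftLinear {P : Type u} [AddCommGroup P] [Module Rᵐᵒᵖ P]
    (f : ∀ X : C, U.obj (Opposite.op X) →+ (F.obj X →ₗ[Rᵐᵒᵖ] P))
    (hf : ∀ (X Y : C) (t : X ⟶ Y) (u : U.obj (Opposite.op Y)) (x : F.obj X),
      forgetLinear (f X) (U.map t.op u) x = forgetLinear (f Y) u (F.map t x)) :
    CTensor U F →ₗ[Rᵐᵒᵖ] P where
  toFun := lift (fun X => forgetLinear (f X)) hf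
  map_add' := map_add _
  map_smul' r z := hom_congr ((lift (fun X => forgetLinear (f X)) hf).comp (act r))
    ((DistribSMul.toAddMonoidHom P r).comp (lift (fun X => forgetLinear (f X)) hf))
    (fun X u x => by simp) z

@[simp] lemma liftLinear_tmul {P : Type u} [AddCommGroup P] [Module Rᵐᵒᵖ P]
    (f : ∀ X : C, U.obj (Opposite.op X) →+ (F.obj X →ₗ[Rᵐᵒᵖ] P))
    (hf : ∀ (X Y : C) (t : X ⟶ Y) (u : U.obj (Opposite.op Y)) (x : F.obj X),
      forgetLinear (f X) (U.map t.op u) x = forgetLinear (f Y) u (F.map t x)) {X : C}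
    (u : U.obj (Opposite.op X)) (x : F.obj X) :
    liftLinear f hf (tmul u x) = f X u x :=
  lift_tmul (fun X => forgetLinear (f X)) hf u x

/-- `x ↦ u ⊗ x` as a linear map. -/
def inclLinear {X : C} (u : U.obj (Opposite.op X)) : F.obj X →ₗ[Rᵐᵒᵖ] CTensor U F where
  toFun x := tmul u x
  map_add' := tmul_add u
  map_smul' r x := (smul_tmul r u x).symm

@[simp] lemma inclLinear_apply {X : C} (u : U.obj (Opposite.op X)) (x : F.obj X) :
    inclLinear u x = tmul u x := rfl

/-- Functoriality of `U ⊗_C F` in `U`. -/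
def map {U V : Cᵒᵖ ⥤ AddCommGrpCat.{u}} (α : U ⟶ V) : CTensor U F →ₗ[Rᵐᵒᵖ] CTensor V F :=
  liftLinear (fun X => AddMonoidHom.mk' (fun u => inclLinear (α.app (Opposite.op X) u))
      (fun u u' => by ext x; simp [add_tmul]))
    (fun X Y t u x => by
      have := NatTrans.naturality_apply α t.op u
      simp only [forgetLinear_apply, AddMonoidHom.mk'_apply, inclLinear_apply]
      rw [this, map_tmul])

@[simp] lemma map_apply_tmul {U V : Cᵒᵖ ⥤ AddCommGrpCat.{u}} (α : U ⟶ V) {X : C}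
    (u : U.obj (Opposite.op X)) (x : F.obj X) :
    map α (tmul u x) = tmul (α.app (Opposite.op X) u) x := liftLinear_tmul _ _ u x

end CTensor

end CTensor

section FiberFunctor

variable {C : Type u} [SmallCategory C] [Preadditive C] {R : Type u} [Ring R]
variable (F : C ⥤ ModuleCat.{u} Rᵐᵒᵖ) [F.Additive]

/-- The category `Add(Cᵒᵖ, Ab)` of additive presheaves of abelian groups on `C`. -/
abbrev Presheaf (C : Type*) [Category* C] [Preadditive C] := Cᵒᵖ ⥤+ AddCommGrpCat.{u}

/-- The left Kan extension `U ↦ U ⊗_C F` of `F` along the Yoneda embedding. -/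
def kanExtension : Presheaf.{u} C ⥤ ModuleCat.{u} Rᵐᵒᵖ where
  obj U := ModuleCat.of Rᵐᵒᵖ (CTensor U.obj F)
  map α := ModuleCat.ofHom (CTensor.map α.hom)
  map_id U := ModuleCat.hom_ext (CTensor.linear_ext fun X u x => by simp)
  map_comp α β := ModuleCat.hom_ext (CTensor.linear_ext fun X u x => by simp)

/-- The presheaf `G = Hom_R(F -, R)`, the pointwise dual of `F`. -/
def dualPresheaf : Presheaf.{u} C :=
  ⟨{ obj X := AddCommGrpCat.of (F.obj X.unop →ₗ[Rᵐᵒᵖ] R)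
     map f := AddCommGrpCat.ofHom
       (AddMonoidHom.mk' (fun g => g.comp (F.map f.unop).hom) (fun g g' => rfl))
     map_id X := by ext; simp
     map_comp f g := by ext; simp },
   { map_add := by intros; ext; simp }⟩

/-- Elements of the dual presheaf as linear maps. -/
abbrev dualMk {X : C} (g : F.obj X →ₗ[Rᵐᵒᵖ] R) : (dualPresheaf F).obj.obj (Opposite.op X) := g

/-- The left action of `r` on the dual presheaf, `(r · g)(x) = r g(x)`. -/
def dualAct (r : R) : (dualPresheaf F).obj ⟶ (dualPresheaf F).obj where
  app X := AddCommGrpCat.ofHom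
    (DistribSMul.toAddMonoidHom (F.obj X.unop →ₗ[Rᵐᵒᵖ] R) r)
  naturality _ _ _ := rfl

/-- The abelian group `G ⊗_C F` underlying the coring of `F`. -/
abbrev CoringCarrier : Type u := CTensor (dualPresheaf F).obj F

/-- The rank one tensor `g ⊗ x` for a linear form `g` on `F X`. -/
def dtmul {X : C} (g : F.obj X →ₗ[Rᵐᵒᵖ] R) (x : F.obj X) : CoringCarrier F :=
  CTensor.tmul (U := (dualPresheaf F).obj) (dualMk F g) x

/-- `g ↦ g ⊗ x` as an additive map. -/
def dtmulLeft {X : C} (x : F.obj X) : (F.obj X →ₗ[Rᵐᵒᵖ] R) →+ CoringCarrier F :=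
  CTensor.tmulLeft (U := (dualPresheaf F).obj) x

/-- `x ↦ g ⊗ x` as a linear map. -/
def dtmulRight {X : C} (g : F.obj X →ₗ[Rᵐᵒᵖ] R) : F.obj X →ₗ[Rᵐᵒᵖ] CoringCarrier F :=
  CTensor.inclLinear (U := (dualPresheaf F).obj) (dualMk F g)

@[simp] lemma dtmulRight_apply {X : C} (g : F.obj X →ₗ[Rᵐᵒᵖ] R) (x : F.obj X) :
    dtmulRight F g x = dtmul F g x := rfl

lemma dtmul_comp {X Y : C} (t : X ⟶ Y) (g : F.obj Y →ₗ[Rᵐᵒᵖ] R) (x : F.obj X) :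
    dtmul F (g.comp (F.map t).hom) x = dtmul F g (F.map t x) :=
  CTensor.map_tmul (U := (dualPresheaf F).obj) t (dualMk F g) x

lemma dtmul_sum_left {X : C} {ι : Type*} (s : Finset ι) (g : ι → (F.obj X →ₗ[Rᵐᵒᵖ] R))
    (x : F.obj X) : dtmul F (∑ i ∈ s, g i) x = ∑ i ∈ s, dtmul F (g i) x :=
  map_sum (dtmulLeft F x) g s

lemma dtmul_add_right {X : C} (g : F.obj X →ₗ[Rᵐᵒᵖ] R) (x y : F.obj X) :
    dtmul F g (x + y) = dtmul F g x + dtmul F g y := CTensor.tmul_add _ x y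

lemma dtmul_sum_right {X : C} {ι : Type*} (s : Finset ι) (g : F.obj X →ₗ[Rᵐᵒᵖ] R)
    (x : ι → F.obj X) : dtmul F g (∑ i ∈ s, x i) = ∑ i ∈ s, dtmul F g (x i) :=
  map_sum (dtmulRight F g) x s

@[simp] lemma smul_dtmul_right (r : Rᵐᵒᵖ) {X : C} (g : F.obj X →ₗ[Rᵐᵒᵖ] R) (x : F.obj X) :
    r • dtmul F g x = dtmul F g (r • x) := CTensor.smul_tmul r _ x

/-- Additive maps out of `G ⊗_C F` are determined by rank one tensors. -/
lemma dtmul_hom_congr {P : Type u} [AddCommGroup P] (a b : CoringCarrier F →+ P)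
    (h : ∀ (X : C) (g : F.obj X →ₗ[Rᵐᵒᵖ] R) (x : F.obj X), a (dtmul F g x) = b (dtmul F g x))
    (z : CoringCarrier F) : a z = b z :=
  CTensor.hom_congr a b h z

/-- The left action of `r` on `G ⊗_C F`. -/
def dAct (r : R) : CoringCarrier F →ₗ[Rᵐᵒᵖ] CoringCarrier F := CTensor.map (dualAct F r)

lemma dAct_dtmul (r : R) {X : C} (g : F.obj X →ₗ[Rᵐᵒᵖ] R) (x : F.obj X) :
    dAct F r (dtmul F g x) = dtmul F (r • g) x := CTensor.map_apply_tmul (dualAct F r) _ x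

/-- `G ⊗_C F` is a left `R`-module by `r · (g ⊗ x) = (r · g) ⊗ x`. -/
instance : Module R (CoringCarrier F) where
  smul r z := dAct F r z
  one_smul z := dtmul_hom_congr F (dAct F 1).toAddMonoidHom (AddMonoidHom.id _)
    (fun X g x => by simp [dAct_dtmul]) z
  mul_smul r s z := dtmul_hom_congr F (dAct F (r * s)).toAddMonoidHom
    ((dAct F r).toAddMonoidHom.comp (dAct F s).toAddMonoidHom)
    (fun X g x => by simp [dAct_dtmul, mul_smul]) z
  smul_zero r := map_zero _
  smul_add r := map_add _
  add_smul r s z := dtmul_hom_congr F (dAct F (r + s)).toAddMonoidHom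
    ((dAct F r).toAddMonoidHom + (dAct F s).toAddMonoidHom)
    (fun X g x => by
      simp only [LinearMap.toAddMonoidHom_coe, AddMonoidHom.add_apply, dAct_dtmul, add_smul]
      exact (dtmulLeft F x).map_add _ _) z
  zero_smul z := dtmul_hom_congr F (dAct F 0).toAddMonoidHom 0
    (fun X g x => by
      simp only [LinearMap.toAddMonoidHom_coe, AddMonoidHom.zero_apply, dAct_dtmul, zero_smul]
      exact (dtmulLeft F x).map_zero) z

@[simp] lemma smul_dtmul_left (r : R) {X : C} (g : F.obj X →ₗ[Rᵐᵒᵖ] R) (x : F.obj X) :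
    r • dtmul F g x = dtmul F (r • g) x := dAct_dtmul F r g x

instance : SMulCommClass R Rᵐᵒᵖ (CoringCarrier F) where
  smul_comm r s z := (dAct F r).map_smul s z

/-- `F X` is a finitely generated projective right `R`-module for every object `X`. -/
def IsFGP (F : C ⥤ ModuleCat.{u} Rᵐᵒᵖ) : Prop :=
  ∀ X : C, Module.Finite Rᵐᵒᵖ (F.obj X) ∧ Module.Projective Rᵐᵒᵖ (F.obj X)

/-- A finite dual basis of a right `R`-module `M`: elements `xᵢ` and linear forms `fᵢ` such that
`y = ∑ i, xᵢ · fᵢ(y)` for all `y`. -/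
structure DualBasis (R : Type u) [Ring R] (M : Type u) [AddCommGroup M] [Module Rᵐᵒᵖ M] where
  /-- The number of elements. -/
  n : ℕ
  /-- The elements. -/
  x : Fin n → M
  /-- The linear forms. -/
  f : Fin n → (M →ₗ[Rᵐᵒᵖ] R)
  sum_smul : ∀ y : M, ∑ i, op (f i y) • x i = y

lemma DualBasis.nonempty (M : Type u) [AddCommGroup M] [Module Rᵐᵒᵖ M]
    (h : Module.Finite Rᵐᵒᵖ M ∧ Module.Projective Rᵐᵒᵖ M) : Nonempty (DualBasis R M) := by
  obtain ⟨h1, h2⟩ := h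
  obtain ⟨n, f, g, -, -, hfg⟩ := Module.Finite.exists_comp_eq_id_of_projective Rᵐᵒᵖ M
  refine ⟨⟨n, fun i => f (Pi.single i 1), fun i =>
    { toFun := fun y => unop (g y i)
      map_add' := fun y z => by simp
      map_smul' := fun r y => by simp }, fun y => ?_⟩⟩
  have h3 : f (g y) = y := LinearMap.congr_fun hfg y
  conv_rhs => rw [← h3, LinearMap.pi_apply_eq_sum_univ f]
  simp only [LinearMap.coe_mk, AddHom.coe_mk, op_unop]
  refine Finset.sum_congr rfl fun i _ => ?_
  congr 2
  ext j
  simp [Pi.single_apply, eq_comm]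

variable {F}

/-- A chosen dual basis of `F X`. None of the constructions below depends on the choice. -/
def dualBasis (hF : IsFGP F) (X : C) : DualBasis R (F.obj X) :=
  (DualBasis.nonempty (F.obj X) (hF X)).some

open BTensor

variable (hF : IsFGP F)

/-- For `a : F X → M`, the linear map `F X → M ⊗_R (G ⊗_C F)`, `x ↦ ∑ i, a(xᵢ) ⊗ (fᵢ ⊗ x)`. -/
def coev {M : Type u} [AddCommGroup M] [Module Rᵐᵒᵖ M] {X : C} (a : F.obj X →ₗ[Rᵐᵒᵖ] M) :
    F.obj X →ₗ[Rᵐᵒᵖ] BTensor R M (CoringCarrier F) where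
  toFun x := ∑ i, tmul R (a ((dualBasis hF X).x i)) (dtmul F ((dualBasis hF X).f i) x)
  map_add' x y := by simp only [dtmul_add_right, BTensor.tmul_add, Finset.sum_add_distrib]
  map_smul' r x := by
    simp only [Finset.smul_sum, smul_tmul_right, smul_dtmul_right, RingHom.id_apply]

lemma coev_apply {M : Type u} [AddCommGroup M] [Module Rᵐᵒᵖ M] {X : C} (a : F.obj X →ₗ[Rᵐᵒᵖ] M)
    (x : F.obj X) : coev hF a x =
      ∑ i, tmul R (a ((dualBasis hF X).x i)) (dtmul F ((dualBasis hF X).f i) x) := rfl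

lemma coev_comp {M : Type u} [AddCommGroup M] [Module Rᵐᵒᵖ M] {X Y : C} (t : X ⟶ Y)
    (a : F.obj Y →ₗ[Rᵐᵒᵖ] M) (x : F.obj X) :
    coev hF (a.comp (F.map t).hom) x = coev hF a (F.map t x) := by
  have h1 : ∀ i, a.comp (F.map t).hom ((dualBasis hF X).x i) =
      ∑ j, op ((dualBasis hF Y).f j (F.map t ((dualBasis hF X).x i))) •
        a ((dualBasis hF Y).x j) := fun i => by
    conv_lhs => rw [LinearMap.comp_apply,
      ← (dualBasis hF Y).sum_smul ((F.map t).hom ((dualBasis hF X).x i)), map_sum]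
    simp only [map_smul]
  have h2 : ∀ j, ∑ i, (dualBasis hF Y).f j (F.map t ((dualBasis hF X).x i)) •
      (dualBasis hF X).f i = ((dualBasis hF Y).f j).comp (F.map t).hom := fun j => by
    ext y
    rw [LinearMap.comp_apply]
    conv_rhs => rw [← (dualBasis hF X).sum_smul y, map_sum, map_sum]
    simp
  rw [coev_apply, coev_apply]
  simp only [h1, BTensor.sum_tmul, op_smul_tmul, smul_dtmul_left]
  rw [Finset.sum_comm]
  refine Finset.sum_congr rfl fun j _ => ?_
  rw [← BTensor.tmul_sum, ← dtmul_sum_left, h2, dtmul_comp]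

/-- The coaction `U ⊗_C F → (U ⊗_C F) ⊗_R (G ⊗_C F)`, `u ⊗ x ↦ ∑ i, (u ⊗ xᵢ) ⊗ (fᵢ ⊗ x)`. -/
def coact (U : Cᵒᵖ ⥤ AddCommGrpCat.{u}) :
    CTensor U F →ₗ[Rᵐᵒᵖ] BTensor R (CTensor U F) (CoringCarrier F) :=
  CTensor.liftLinear (fun X => AddMonoidHom.mk' (fun u => coev hF (CTensor.inclLinear u))
      (fun u u' => by
        ext x
        simp [coev_apply, CTensor.add_tmul, BTensor.add_tmul, Finset.sum_add_distrib]))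
    (fun X Y t u x => by
      simp only [CTensor.forgetLinear_apply, AddMonoidHom.mk'_apply]
      rw [← coev_comp]
      congr 2
      ext y
      exact CTensor.map_tmul t u y)

lemma coact_tmul (U : Cᵒᵖ ⥤ AddCommGrpCat.{u}) {X : C} (u : U.obj (Opposite.op X))
    (x : F.obj X) : coact hF U (CTensor.tmul u x) = coev hF (CTensor.inclLinear u) x :=
  CTensor.liftLinear_tmul _ _ u x

/-- The counit `G ⊗_C F → R`, `g ⊗ x ↦ g(x)`. -/
def evalMap (F : C ⥤ ModuleCat.{u} Rᵐᵒᵖ) [F.Additive] : CoringCarrier F →ₗ[Rᵐᵒᵖ] R :=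
  CTensor.liftLinear (U := (dualPresheaf F).obj)
    (fun X => AddMonoidHom.id (F.obj X →ₗ[Rᵐᵒᵖ] R)) (fun _ _ _ _ _ => rfl)

@[simp] lemma evalMap_dtmul {X : C} (g : F.obj X →ₗ[Rᵐᵒᵖ] R) (x : F.obj X) :
    evalMap F (dtmul F g x) = g x :=
  CTensor.liftLinear_tmul _ _ _ x

/-- The comultiplication `g ⊗ x ↦ ∑ i, (g ⊗ xᵢ) ⊗ (fᵢ ⊗ x)` as an additive map. -/
def comulHom : CoringCarrier F →+ BTensor R (CoringCarrier F) (CoringCarrier F) :=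
  (coact hF (dualPresheaf F).obj).toAddMonoidHom

lemma comulHom_dtmul {X : C} (g : F.obj X →ₗ[Rᵐᵒᵖ] R) (x : F.obj X) :
    comulHom hF (dtmul F g x) = coev hF (dtmulRight F g) x :=
  coact_tmul hF (dualPresheaf F).obj _ x

lemma comulHom_smul (r : R) (h : CoringCarrier F) :
    comulHom hF (r • h) = r • comulHom hF h :=
  dtmul_hom_congr F ((comulHom hF).comp (DistribSMul.toAddMonoidHom _ r))
    ((DistribSMul.toAddMonoidHom _ r).comp (comulHom hF))
    (fun X g x => by simp [comulHom_dtmul, coev_apply]) h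

lemma comulHom_op_smul (r : R) (h : CoringCarrier F) :
    comulHom hF (op r • h) = op r • comulHom hF h :=
  (coact hF (dualPresheaf F).obj).map_smul (op r) h

lemma coact_op_smul (U : Cᵒᵖ ⥤ AddCommGrpCat.{u}) (r : R) (z : CTensor U F) :
    (coact hF U).toAddMonoidHom (op r • z) = op r • (coact hF U).toAddMonoidHom z :=
  (coact hF U).map_smul (op r) z

/-- The counit as an additive map. -/
def counitHom (F : C ⥤ ModuleCat.{u} Rᵐᵒᵖ) [F.Additive] : CoringCarrier F →+ R :=
  (evalMap F).toAddMonoidHom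

@[simp] lemma counitHom_dtmul {X : C} (g : F.obj X →ₗ[Rᵐᵒᵖ] R) (x : F.obj X) :
    counitHom F (dtmul F g x) = g x := evalMap_dtmul g x

lemma counitHom_smul (r : R) (h : CoringCarrier F) :
    counitHom F (r • h) = r • counitHom F h :=
  dtmul_hom_congr F ((counitHom F).comp (DistribSMul.toAddMonoidHom _ r))
    ((DistribSMul.toAddMonoidHom _ r).comp (counitHom F)) (fun X g x => by simp) h

lemma counitHom_op_smul (r : R) (h : CoringCarrier F) :
    counitHom F (op r • h) = op r • counitHom F h :=
  (evalMap F).map_smul (op r) h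

lemma coact_coassoc (U : Cᵒᵖ ⥤ AddCommGrpCat.{u}) (z : CTensor U F) :
    assocInv (lTensor (comulHom hF) (comulHom_smul hF) (coact hF U z)) =
      rTensor (coact hF U).toAddMonoidHom (coact_op_smul hF U) (coact hF U z) :=
  CTensor.hom_congr
    ((assocInv.comp (lTensor (comulHom hF) (comulHom_smul hF))).comp
      (coact hF U).toAddMonoidHom)
    ((rTensor (coact hF U).toAddMonoidHom (coact_op_smul hF U)).comp
      (coact hF U).toAddMonoidHom)
    (fun X u x => by
      simp only [AddMonoidHom.comp_apply, LinearMap.toAddMonoidHom_coe, coact_tmul, coev_apply,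
        map_sum, lTensor_tmul, rTensor_tmul, comulHom_dtmul, BTensor.tmul_sum, BTensor.sum_tmul,
        assocInv_tmul, CTensor.inclLinear_apply, dtmulRight_apply]
      rw [Finset.sum_comm]) z

lemma coact_counit (U : Cᵒᵖ ⥤ AddCommGrpCat.{u}) (z : CTensor U F) :
    rid (lTensor (counitHom F) counitHom_smul (coact hF U z)) = z :=
  CTensor.hom_congr
    ((rid.comp (lTensor (counitHom F) counitHom_smul)).comp (coact hF U).toAddMonoidHom)
    (AddMonoidHom.id _)
    (fun X u x => by
      simp only [AddMonoidHom.comp_apply, LinearMap.toAddMonoidHom_coe, coact_tmul, coev_apply,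
        map_sum, lTensor_tmul, rid_tmul, counitHom_dtmul, CTensor.inclLinear_apply,
        CTensor.smul_tmul, AddMonoidHom.id_apply]
      rw [← CTensor.tmul_sum, (dualBasis hF X).sum_smul]) z

/-- The `R`-coring `H = G ⊗_C F`, with comultiplication
`g ⊗ x ↦ ∑ i, (g ⊗ xᵢ) ⊗ (fᵢ ⊗ x)` and counit `g ⊗ x ↦ g(x)`. -/
def coring : Coring R where
  carrier := CoringCarrier F
  comul := comulHom hF
  comul_smul := comulHom_smul hF
  comul_op_smul := comulHom_op_smul hF
  counit := counitHom F
  counit_smul := counitHom_smul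
  counit_op_smul := counitHom_op_smul
  coassoc := coact_coassoc hF (dualPresheaf F).obj
  lid_counit h := dtmul_hom_congr F
    ((lid.comp (rTensor (counitHom F) counitHom_op_smul)).comp (comulHom hF))
    (AddMonoidHom.id _)
    (fun X g x => by
      simp only [AddMonoidHom.comp_apply, comulHom_dtmul, coev_apply, map_sum, rTensor_tmul,
        lid_tmul, dtmulRight_apply, counitHom_dtmul, smul_dtmul_left, AddMonoidHom.id_apply]
      rw [← dtmul_sum_left]
      congr 1
      ext y
      conv_rhs => rw [← (dualBasis hF X).sum_smul y, map_sum]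
      simp) h
  rid_counit := coact_counit hF (dualPresheaf F).obj

/-! ### The comparison functor and the idempotent monad -/

/-- The comparison functor `K : Add(Cᵒᵖ, Ab) ⥤ 𝓜^H`, which equips `U ⊗_C F` with the coaction
`u ⊗ x ↦ ∑ i, (u ⊗ xᵢ) ⊗ (fᵢ ⊗ x)`. -/
def comparison : Presheaf.{u} C ⥤ (coring hF).Comodule where
  obj U :=
    { A := (kanExtension F).obj U
      a := ModuleCat.ofHom (coact hF U.obj)
      counit := ModuleCat.hom_ext (LinearMap.ext (coact_counit hF U.obj))
      coassoc := ModuleCat.hom_ext (LinearMap.ext (coact_coassoc hF U.obj)) }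
  map {U V} α :=
    { f := (kanExtension F).map α
      h := ModuleCat.hom_ext (CTensor.linear_ext fun X u x => by
        change (coring hF).tensorMap (CTensor.map α.hom) (coact hF U.obj (CTensor.tmul u x)) =
          coact hF V.obj (CTensor.map α.hom (CTensor.tmul u x))
        rw [CTensor.map_apply_tmul, coact_tmul, coact_tmul, coev_apply, coev_apply]
        refine (map_sum ((coring hF).tensorMap (CTensor.map α.hom)) _ _).trans ?_
        refine Finset.sum_congr rfl fun i _ => ?_
        refine ((coring hF).tensorMap_tmul _ _ _).trans ?_
        exact congrArg (fun z => tmul R z (dtmul F ((dualBasis hF X).f i) x))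
          (CTensor.map_apply_tmul α.hom u ((dualBasis hF X).x i))) }
  map_id U := Comonad.Coalgebra.Hom.ext ((kanExtension F).map_id U)
  map_comp α β := Comonad.Coalgebra.Hom.ext ((kanExtension F).map_comp α β)

/-- The functor `k : C ⥤ 𝓜^H`, which equips `F X` with the coaction `x ↦ ∑ i, xᵢ ⊗ (fᵢ ⊗ x)`. -/
def comoduleFunctor : C ⥤ (coring hF).Comodule where
  obj X :=
    { A := F.obj X
      a := ModuleCat.ofHom (coev hF LinearMap.id)
      counit := ModuleCat.hom_ext (LinearMap.ext fun x => by
        change rid (lTensor (counitHom F) counitHom_smul (coev hF LinearMap.id x)) = x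
        simp only [coev_apply, map_sum, lTensor_tmul, rid_tmul, counitHom_dtmul, LinearMap.id_apply]
        exact (dualBasis hF X).sum_smul x)
      coassoc := ModuleCat.hom_ext (LinearMap.ext fun x => by
        change assocInv (lTensor (comulHom hF) (comulHom_smul hF) (coev hF LinearMap.id x)) =
          rTensor (coev hF LinearMap.id).toAddMonoidHom
            (Coring.toAddMonoidHom_op_smul (coev hF LinearMap.id)) (coev hF LinearMap.id x)
        simp only [LinearMap.toAddMonoidHom_coe, coev_apply, map_sum, lTensor_tmul, rTensor_tmul,
          comulHom_dtmul, BTensor.tmul_sum, BTensor.sum_tmul, assocInv_tmul, LinearMap.id_apply,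
          dtmulRight_apply]
        rw [Finset.sum_comm]) }
  map {X Y} t :=
    { f := F.map t
      h := ModuleCat.hom_ext (LinearMap.ext fun x => by
        change (coring hF).tensorMap (F.map t).hom (coev hF LinearMap.id x) =
          coev hF LinearMap.id (F.map t x)
        rw [← coev_comp, coev_apply, coev_apply]
        refine (map_sum ((coring hF).tensorMap (F.map t).hom) _ _).trans ?_
        exact Finset.sum_congr rfl fun i _ => (coring hF).tensorMap_tmul _ _ _) }
  map_id X := Comonad.Coalgebra.Hom.ext (F.map_id X)
  map_comp t s := Comonad.Coalgebra.Hom.ext (F.map_comp t s)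

instance : (comoduleFunctor hF).Additive where
  map_add {_ _ f g} := Comonad.Coalgebra.Hom.ext (F.map_add (f := f) (g := g))

/-- The functor `L : 𝓜^H ⥤ Add(Cᵒᵖ, Ab)`, `L M = 𝓜^H(k -, M)`. -/
def comparisonRight : (coring hF).Comodule ⥤ Presheaf.{u} C :=
  restrictedYoneda (comoduleFunctor hF)

variable {hF}

/-- The linear map underlying a homomorphism `k X → M` of comodules. -/
def homLinear {X : C} {M : (coring hF).Comodule} (φ : (comoduleFunctor hF).obj X ⟶ M) :
    F.obj X →ₗ[Rᵐᵒᵖ] M.A := φ.f.hom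

/-- The coaction of a comodule as a linear map. -/
def coaction (M : (coring hF).Comodule) : M.A →ₗ[Rᵐᵒᵖ] BTensor R M.A (CoringCarrier F) := M.a.hom

lemma coaction_homLinear {X : C} {M : (coring hF).Comodule}
    (φ : (comoduleFunctor hF).obj X ⟶ M) (x : F.obj X) :
    coaction M (homLinear φ x) = coev hF (homLinear φ) x := by
  have h1 : (coring hF).tensorMap (homLinear φ) (coev hF LinearMap.id x) =
      coaction M (homLinear φ x) :=
    LinearMap.congr_fun (congrArg ModuleCat.Hom.hom φ.h) x
  rw [← h1, coev_apply, coev_apply]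
  refine (map_sum ((coring hF).tensorMap (homLinear φ)) _ _).trans ?_
  exact Finset.sum_congr rfl fun i _ => (coring hF).tensorMap_tmul _ _ _

variable (hF)

/-- For `u ∈ U X`, the comodule homomorphism `k X → K U`, `x ↦ u ⊗ x`. -/
def elementHom (U : Presheaf.{u} C) {X : C} (u : U.obj.obj (Opposite.op X)) :
    (comoduleFunctor hF).obj X ⟶ (comparison hF).obj U :=
  { f := ModuleCat.ofHom (CTensor.inclLinear u)
    h := by
      have key : ∀ x : F.obj X,
          (coring hF).tensorMap (CTensor.inclLinear u) (coev hF LinearMap.id x) =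
            coact hF U.obj (CTensor.tmul u x) := fun x => by
        rw [coact_tmul, coev_apply, coev_apply]
        refine (map_sum ((coring hF).tensorMap (CTensor.inclLinear u)) _ _).trans ?_
        exact Finset.sum_congr rfl fun i _ => (coring hF).tensorMap_tmul _ _ _
      exact ModuleCat.hom_ext (LinearMap.ext key) }

variable {hF} {U : Presheaf.{u} C} {M : (coring hF).Comodule}

/-- The transpose `U → L M` of a comodule homomorphism `φ : K U → M`; it sends `u ∈ U X` to
`x ↦ φ(u ⊗ x)`. -/
def transposeRight (φ : (comparison hF).obj U ⟶ M) : U ⟶ (comparisonRight hF).obj M :=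
  ObjectProperty.homMk
    { app X := AddCommGrpCat.ofHom (AddMonoidHom.mk'
        (fun u : U.obj.obj X => (elementHom hF U (X := X.unop) u ≫ φ :
          (comoduleFunctor hF).obj X.unop ⟶ M))
        (fun u u' => by
          rw [← Preadditive.add_comp]
          congr 1
          refine Comonad.Coalgebra.Hom.ext (ModuleCat.hom_ext (LinearMap.ext fun x => ?_))
          exact CTensor.add_tmul u u' x))
      naturality _ _ t := by
        ext u
        refine Comonad.Coalgebra.Hom.ext (ModuleCat.hom_ext (LinearMap.ext fun x => ?_))
        exact congrArg φ.f.hom (CTensor.map_tmul t.unop u x) }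

/-- The value of `ψ : U → L M` at `u ∈ U X`, as a homomorphism `k X → M`. -/
def evalHom (ψ : U ⟶ (comparisonRight hF).obj M) (X : C) :
    U.obj.obj (Opposite.op X) →+ ((comoduleFunctor hF).obj X ⟶ M) :=
  (ψ.hom.app (Opposite.op X)).hom

/-- The value of `ψ : U → L M` at `u ∈ U X`, as a linear map `F X → M`. -/
def evalLinear (ψ : U ⟶ (comparisonRight hF).obj M) (X : C) :
    U.obj.obj (Opposite.op X) →+ (F.obj X →ₗ[Rᵐᵒᵖ] M.A) :=
  AddMonoidHom.mk' (fun u => homLinear (evalHom ψ X u)) (fun u u' => by rw [map_add]; rfl)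

lemma evalLinear_balanced (ψ : U ⟶ (comparisonRight hF).obj M) (X Y : C) (t : X ⟶ Y)
    (u : U.obj.obj (Opposite.op Y)) (x : F.obj X) :
    CTensor.forgetLinear (evalLinear ψ X) (U.obj.map t.op u) x =
      CTensor.forgetLinear (evalLinear ψ Y) u (F.map t x) := by
  have h : evalHom ψ X (U.obj.map t.op u) = (comoduleFunctor hF).map t ≫ evalHom ψ Y u :=
    NatTrans.naturality_apply ψ.hom t.op u
  exact congrArg (fun φ => homLinear φ x) h

/-- The linear map `u ⊗ x ↦ ψ(u)(x)`. -/
def transposeLinear (ψ : U ⟶ (comparisonRight hF).obj M) : CTensor U.obj F →ₗ[Rᵐᵒᵖ] M.A :=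
  CTensor.liftLinear (evalLinear ψ) (evalLinear_balanced ψ)

lemma transposeLinear_tmul (ψ : U ⟶ (comparisonRight hF).obj M) {X : C}
    (u : U.obj.obj (Opposite.op X)) (x : F.obj X) :
    transposeLinear ψ (CTensor.tmul u x) = homLinear (evalHom ψ X u) x :=
  CTensor.liftLinear_tmul (evalLinear ψ) (evalLinear_balanced ψ) u x

/-- The transpose `K U → M` of `ψ : U → L M`, `u ⊗ x ↦ ψ(u)(x)`. -/
def transposeLeft (ψ : U ⟶ (comparisonRight hF).obj M) : (comparison hF).obj U ⟶ M :=
  { f := ModuleCat.ofHom (transposeLinear ψ)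
    h := by
      have key : ∀ (X : C) (u : U.obj.obj (Opposite.op X)) (x : F.obj X),
          (coring hF).tensorMap (transposeLinear ψ) (coact hF U.obj (CTensor.tmul u x)) =
            coaction M (transposeLinear ψ (CTensor.tmul u x)) := fun X u x => by
        rw [transposeLinear_tmul, coaction_homLinear, coact_tmul, coev_apply, coev_apply]
        refine (map_sum ((coring hF).tensorMap (transposeLinear ψ)) _ _).trans ?_
        refine Finset.sum_congr rfl fun i _ => ?_
        refine ((coring hF).tensorMap_tmul _ _ _).trans ?_
        exact congrArg (fun z => tmul R z (dtmul F ((dualBasis hF X).f i) x))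
          (transposeLinear_tmul ψ u ((dualBasis hF X).x i))
      exact ModuleCat.hom_ext (CTensor.linear_ext key) }

/-- Homomorphisms out of `K U` are determined by the values on rank one tensors. -/
lemma comparison_hom_ext {φ φ' : (comparison hF).obj U ⟶ M}
    (h : ∀ (X : C) (u : U.obj.obj (Opposite.op X)) (x : F.obj X),
      φ.f.hom (CTensor.tmul u x) = φ'.f.hom (CTensor.tmul u x)) : φ = φ' :=
  Comonad.Coalgebra.Hom.ext (ModuleCat.hom_ext (CTensor.linear_ext h))

lemma transposeLeft_tmul (ψ : U ⟶ (comparisonRight hF).obj M) {X : C}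
    (u : U.obj.obj (Opposite.op X)) (x : F.obj X) :
    (transposeLeft ψ).f.hom (CTensor.tmul u x) = homLinear (evalHom ψ X u) x :=
  transposeLinear_tmul ψ u x

variable (hF)

/-- The adjunction `K ⊣ L`. -/
def comparisonAdjunction : comparison hF ⊣ comparisonRight hF :=
  Adjunction.mkOfHomEquiv
    { homEquiv U M :=
        { toFun := transposeRight
          invFun := transposeLeft
          left_inv φ := comparison_hom_ext fun X u x => transposeLeft_tmul (transposeRight φ) u x
          right_inv ψ := by
            ext X u
            refine Comonad.Coalgebra.Hom.ext (ModuleCat.hom_ext (LinearMap.ext fun x => ?_))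
            exact transposeLeft_tmul ψ u x }
      homEquiv_naturality_left_symm {U V M} f g := comparison_hom_ext fun X u x => by
        refine (transposeLeft_tmul (f ≫ g) u x).trans ?_
        refine Eq.trans ?_ (congrArg (transposeLeft g).f.hom (CTensor.map_apply_tmul f.hom u x)).symm
        exact (transposeLeft_tmul g (f.hom.app (Opposite.op X) u) x).symm
      homEquiv_naturality_right _ _ := rfl }

/-- The idempotent monad `T = L K` on the category of presheaves. -/
def sheafMonad : Monad (Presheaf.{u} C) := (comparisonAdjunction hF).toMonad

end FiberFunctor

/-! ### Additive Grothendieck topologies -/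

section Topology

variable {C : Type u} [SmallCategory C] [Preadditive C]

/-- An additive sieve on `X`: an additive subfunctor of the representable presheaf `C(-, X)`. -/
@[ext]
structure LinearSieve (X : C) where
  /-- The arrows with source `Y` which belong to the sieve. -/
  arrows : ∀ Y : C, AddSubgroup (Y ⟶ X)
  comp_mem : ∀ {Y Z : C} (g : Z ⟶ Y) {s : Y ⟶ X}, s ∈ arrows Y → g ≫ s ∈ arrows Z

/-- The maximal sieve. -/
def LinearSieve.maximal (X : C) : LinearSieve X where
  arrows _ := ⊤
  comp_mem _ _ _ := AddSubgroup.mem_top _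

/-- The pullback of a sieve along `f`. -/
def LinearSieve.pullback {X Y : C} (f : Y ⟶ X) (S : LinearSieve X) : LinearSieve Y where
  arrows Z := (S.arrows Z).comap (Preadditive.rightComp Z f)
  comp_mem {Z W} g s hs := by
    have h : s ≫ f ∈ S.arrows Z := hs
    change (g ≫ s) ≫ f ∈ S.arrows W
    rw [Category.assoc]
    exact S.comp_mem g h

lemma LinearSieve.mem_pullback {X Y Z : C} (f : Y ⟶ X) (S : LinearSieve X) (g : Z ⟶ Y) :
    g ∈ (S.pullback f).arrows Z ↔ g ≫ f ∈ S.arrows Z := Iff.rfl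

variable (C) in
/-- A Grothendieck topology on the preadditive category `C`, consisting of additive sieves. -/
@[ext]
structure LinearTopology where
  /-- The covering sieves of `X`. -/
  covers : ∀ X : C, Set (LinearSieve X)
  maximal_mem : ∀ X : C, LinearSieve.maximal X ∈ covers X
  pullback_mem : ∀ {X Y : C} (f : Y ⟶ X) {S : LinearSieve X}, S ∈ covers X →
    S.pullback f ∈ covers Y
  transitive : ∀ {X : C} {S : LinearSieve X}, S ∈ covers X → ∀ T : LinearSieve X,
    (∀ (Y : C) (s : Y ⟶ X), s ∈ S.arrows Y → T.pullback s ∈ covers Y) → T ∈ covers X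

/-- A topology is coarser than another one if it has fewer covering sieves. -/
instance : LE (LinearTopology C) where
  le J J' := ∀ X : C, J.covers X ⊆ J'.covers X

variable (C) in
/-- The coarsest topology: the only covering sieve of `X` is the maximal one. -/
def LinearTopology.coarsest : LinearTopology C where
  covers X := {LinearSieve.maximal X}
  maximal_mem _ := rfl
  pullback_mem {X Y} f S hS := by
    rw [Set.mem_singleton_iff] at hS ⊢
    subst hS
    rfl
  transitive {X S} hS T hT := by
    rw [Set.mem_singleton_iff] at hS ⊢
    subst hS
    have h := hT X (𝟙 X) (AddSubgroup.mem_top _)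
    rw [Set.mem_singleton_iff] at h
    rw [← h]
    ext Y g
    rw [LinearSieve.mem_pullback, Category.comp_id]

lemma LinearTopology.coarsest_le (J : LinearTopology C) : coarsest C ≤ J := by
  rintro X S rfl
  exact J.maximal_mem X

variable {R : Type u} [Ring R]

/-- A functor `F : C ⥤ 𝓜_R` is flat if the category of elements of its underlying set-valued
functor is cofiltered. -/
def IsFlat (F : C ⥤ ModuleCat.{u} Rᵐᵒᵖ) : Prop :=
  IsCofiltered (F ⋙ forget (ModuleCat.{u} Rᵐᵒᵖ)).Elements

/-- The topology of a flat functor `F`, whose covering sieves are the jointly `F`-epimorphic ones: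
every `x ∈ F X` is of the form `F(s)(y)` for some arrow `s` of the sieve. -/
def functorTopology (F : C ⥤ ModuleCat.{u} Rᵐᵒᵖ) (hF : IsFlat F) : LinearTopology C where
  covers X := {S | ∀ x : F.obj X, ∃ (Y : C) (s : Y ⟶ X) (y : F.obj Y),
    s ∈ S.arrows Y ∧ F.map s y = x}
  maximal_mem X x := ⟨X, 𝟙 X, x, AddSubgroup.mem_top _, by simp⟩
  pullback_mem {X Y} f S hS y := by
    obtain ⟨Z, s, z, hs, hz⟩ := hS (F.map f y)
    have : IsCofiltered (F ⋙ forget (ModuleCat.{u} Rᵐᵒᵖ)).Elements := hF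
    let P := F ⋙ forget (ModuleCat.{u} Rᵐᵒᵖ)
    let a : P.elementsMk Y y ⟶ P.elementsMk X (F.map f y) := ⟨f, rfl⟩
    let b : P.elementsMk Z z ⟶ P.elementsMk X (F.map f y) := ⟨s, hz⟩
    obtain ⟨W, p, q, hpq⟩ := IsCofiltered.cospan a b
    refine ⟨W.1, p.1, W.2, ?_, p.2⟩
    have h : p.1 ≫ f = q.1 ≫ s := congrArg Subtype.val hpq
    rw [LinearSieve.mem_pullback, h]
    exact S.comp_mem q.1 hs
  transitive {X S} hS T hT x := by
    obtain ⟨Y, s, y, hs, rfl⟩ := hS x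
    obtain ⟨Z, t, z, ht, rfl⟩ := hT Y s hs y
    exact ⟨Z, t ≫ s, z, ht, by simp⟩

end Topology

/-! ### Fiber functors and coarse corings -/

/-- The conditions for an additive functor `F : C ⥤ 𝓜_R` to be a (non-monoidal) fiber functor.
The arrow `F t` is von Neumann regular if `F t ∘ v ∘ F t = F t` for some `v`. -/
structure IsFiberFunctor {C : Type u} [SmallCategory C] [Preadditive C] {R : Type u} [Ring R]
    (F : C ⥤ ModuleCat.{u} Rᵐᵒᵖ) : Prop where
  faithful : F.Faithful
  flat : IsFlat F
  reflectsIsomorphisms : F.ReflectsIsomorphisms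
  fgp : IsFGP F
  hasKernel : ∀ ⦃X Y : C⦄ (t : X ⟶ Y), Epi (F.map t) → HasKernel t
  hasCokernel : ∀ ⦃X Y : C⦄ (t : X ⟶ Y),
    (∃ v : F.obj Y ⟶ F.obj X, F.map t ≫ v ≫ F.map t = F.map t) → HasCokernel t
  preservesCokernel : ∀ ⦃X Y : C⦄ (t : X ⟶ Y),
    (∃ v : F.obj Y ⟶ F.obj X, F.map t ≫ v ≫ F.map t = F.map t) →
      PreservesColimit (parallelPair t 0) F

/-- An `R`-coring `H` is coarse if `M ↦ 𝓜^H(-, M)` is an equivalence from `𝓜^H` to the category of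
additive presheaves on `𝓜^H_fgp`. -/
def Coring.IsCoarse {R : Type u} [Ring R] (H : Coring R) : Prop :=
  (restrictedYoneda H.fgpProperty.ι :
    H.Comodule ⥤ (H.FGPComoduleᵒᵖ ⥤+ AddCommGrpCat.{u})).IsEquivalence

end Category

end

end CoarseFiber

/-! Flatness and biproducts make `U ⊗_C F` computable: every element is a single tensor `u ⊗ x`
(`CTensor.exists_tmul`), and two such tensors agree exactly when `u` and `v` restrict to the same
element along arrows that carry one point of the fiber to `x` and `y` (`CTensor.tmul_eq_iff`).
Statements about the Kan extension thus become statements holding locally for the topology of `F`.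
If only maximal sieves cover, local means global, so the Kan extension detects zero elements and
reflects isomorphisms (`CoversTrivially.eq_zero`, `CoversTrivially.reflectsIsomorphisms`).
Conversely, a covering sieve `S` yields a presheaf `C(-, X) / S` killed by the Kan extension;
faithfulness makes it zero, so `S` is maximal (`coversTrivially_of_faithful`). Split epimorphisms
enter because `F X` is finitely generated projective: a covering sieve contains one arrow whose
image under `F` is surjective, hence split.

Independently of all seven conditions, the counit of `K ⊣ L` is invertible (`isIso_counit`). Dual
bases identify `Hom_R(F -, M) ⊗_C F` with `M ⊗_R H`, so the coaction of `m` is some `a ⊗ x`;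
coassociativity says that `a` satisfies the comodule condition at `x`, and flatness makes it a
comodule homomorphism after restriction. Hence `K` is an equivalence iff the unit is invertible, iff
the monad is trivial. By a triangle identity `K` inverts the unit, so it suffices that the Kan
extension, which is `K` followed by the forgetful functor, reflects isomorphisms. Comonadicity
passes from the forgetful functor to this composite when `K` is an equivalence, and a comonadic
functor is faithful.

For coarse corings, the kernel and cokernel axioms show that `k` is an equivalence from `C` to
`𝓜^H_fgp` (`IsFiberFunctor.full`, `IsFiberFunctor.exists_iso`). Restriction along it turns `M ↦
𝓜^H(-, M)` into `L`. -/

namespace CoarseFiber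

noncomputable section

/-! ### Equalizing arrows at a point of a flat functor -/

section Flat

variable {C : Type u} [SmallCategory C] {R : Type u} [Ring R]
variable {F : C ⥤ ModuleCat.{u} Rᵐᵒᵖ}

lemma IsFlat.exists_equalizing (h : IsFlat F) {X Y : C} (f g : X ⟶ Y) (x : F.obj X)
    (e : F.map f x = F.map g x) :
    ∃ (W : C) (w : F.obj W) (p : W ⟶ X), F.map p w = x ∧ p ≫ f = p ≫ g := by
  have : IsCofiltered (F ⋙ forget (ModuleCat.{u} Rᵐᵒᵖ)).Elements := h
  let P := F ⋙ forget (ModuleCat.{u} Rᵐᵒᵖ)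
  let a : P.elementsMk X x ⟶ P.elementsMk Y (F.map g x) := ⟨f, e⟩
  let b : P.elementsMk X x ⟶ P.elementsMk Y (F.map g x) := ⟨g, rfl⟩
  exact ⟨(IsCofiltered.eq a b).1, (IsCofiltered.eq a b).2, (IsCofiltered.eqHom a b).1,
    (IsCofiltered.eqHom a b).2, congrArg Subtype.val (IsCofiltered.eq_condition a b)⟩

end Flat

/-! ### Rank one tensors over a category with biproducts -/

section RankOne

attribute [local instance] hasBinaryBiproducts_of_finite_biproducts

variable {C : Type u} [SmallCategory C] [Preadditive C] [HasFiniteBiproducts C]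
  {R : Type u} [Ring R]
variable {F : C ⥤ ModuleCat.{u} Rᵐᵒᵖ} [F.Additive] {U : Cᵒᵖ ⥤ AddCommGrpCat.{u}}

omit [Preadditive C] [HasFiniteBiproducts C] [F.Additive] in
lemma map_comp_elem {X Y Z : C} (f : X ⟶ Y) (g : Y ⟶ Z) (x : F.obj X) :
    F.map g (F.map f x) = F.map (f ≫ g) x := by simp

lemma map_fst_pair {X Y : C} (x : F.obj X) (y : F.obj Y) :
    F.map (biprod.fst : X ⊞ Y ⟶ X) (F.map biprod.inl x + F.map biprod.inr y) = x := by
  rw [map_add, map_comp_elem, map_comp_elem, biprod.inl_fst, biprod.inr_fst, F.map_zero]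
  simp

lemma map_snd_pair {X Y : C} (x : F.obj X) (y : F.obj Y) :
    F.map (biprod.snd : X ⊞ Y ⟶ Y) (F.map biprod.inl x + F.map biprod.inr y) = y := by
  rw [map_add, map_comp_elem, map_comp_elem, biprod.inl_snd, biprod.inr_snd, F.map_zero]
  simp

/-- Every element of `U ⊗_C F` is a rank one tensor. -/
lemma CTensor.exists_tmul (z : CTensor U F) :
    ∃ (X : C) (u : U.obj (Opposite.op X)) (x : F.obj X), z = CTensor.tmul u x := by
  classical
  have hadd : ∀ a b : CTensor U F,
      (∃ (X : C) (u : U.obj (Opposite.op X)) (x : F.obj X), a = CTensor.tmul u x) →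
      (∃ (X : C) (u : U.obj (Opposite.op X)) (x : F.obj X), b = CTensor.tmul u x) →
      ∃ (X : C) (u : U.obj (Opposite.op X)) (x : F.obj X), a + b = CTensor.tmul u x := by
    rintro _ _ ⟨X, u, x, rfl⟩ ⟨Y, v, y, rfl⟩
    -- The pair `(x, y)` is a point of `F (X ⊞ Y)`; pulling `u` and `v` back along the projections
    -- and moving these across the tensor recovers both summands.
    refine ⟨X ⊞ Y, U.map biprod.fst.op u + U.map biprod.snd.op v,
      F.map biprod.inl x + F.map biprod.inr y, ?_⟩
    rw [CTensor.add_tmul, CTensor.map_tmul, CTensor.map_tmul, map_fst_pair, map_snd_pair]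
  have hzero : ∃ (X : C) (u : U.obj (Opposite.op X)) (x : F.obj X),
      (0 : CTensor U F) = CTensor.tmul u x :=
    -- No object is given at this point, so the empty biproduct supplies one.
    ⟨biproduct (fun i : Fin 0 => i.elim0), 0, 0, (CTensor.tmul_zero _).symm⟩
  obtain ⟨z, rfl⟩ := QuotientAddGroup.mk_surjective z
  change ∃ (X : C) (u : U.obj (Opposite.op X)) (x : F.obj X), CTensor.proj U F z = CTensor.tmul u x
  induction z using DirectSum.induction_on with
  | zero => simpa using hzero
  | of X y =>
    change ∃ (X' : C) (u : U.obj (Opposite.op X')) (x : F.obj X'),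
      CTensor.proj U F (PreCTensor.incl U F X y) = CTensor.tmul u x
    induction y using TensorProduct.induction_on with
    | zero => simpa using hzero
    | tmul u x => exact ⟨X, u, x, rfl⟩
    | add a b ha hb => rw [map_add, map_add]; exact hadd _ _ ha hb
  | add a b ha hb => rw [map_add]; exact hadd _ _ ha hb

/-- The diagram of the values of `U` on the elements of `F`. -/
abbrev elementsDiagram (U : Cᵒᵖ ⥤ AddCommGrpCat.{u}) (F : C ⥤ ModuleCat.{u} Rᵐᵒᵖ) :
    (F ⋙ forget (ModuleCat.{u} Rᵐᵒᵖ)).Elementsᵒᵖ ⥤ AddCommGrpCat.{u} :=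
  (CategoryOfElements.π (F ⋙ forget (ModuleCat.{u} Rᵐᵒᵖ))).op ⋙ U

/-- The coprojection at `(X, x)` into the colimit of the values of `U` on the elements of `F`. -/
def elementsι (U : Cᵒᵖ ⥤ AddCommGrpCat.{u}) (F : C ⥤ ModuleCat.{u} Rᵐᵒᵖ) {X : C} (x : F.obj X) :
    U.obj (Opposite.op X) →+ (colimit (elementsDiagram U F) : AddCommGrpCat.{u}) :=
  (colimit.ι (elementsDiagram U F) (Opposite.op
    ((F ⋙ forget (ModuleCat.{u} Rᵐᵒᵖ)).elementsMk X x))).hom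

omit [Preadditive C] [HasFiniteBiproducts C] [F.Additive] in
lemma elementsι_map {X Y : C} (t : X ⟶ Y) (x : F.obj X) (y : F.obj Y) (h : F.map t x = y)
    (u : U.obj (Opposite.op Y)) :
    elementsι U F x (U.map t.op u) = elementsι U F y u := by
  let P := F ⋙ forget (ModuleCat.{u} Rᵐᵒᵖ)
  let a : P.elementsMk X x ⟶ P.elementsMk Y y := ⟨t, h⟩
  exact congrArg (fun f => f.hom u) (colimit.w (elementsDiagram U F) a.op)

/-- The points `x`, `y` and `x + y` are the images of one point `(x, y)` of `F (X ⊞ X)` under `fst`,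
`snd` and `fst + snd`, so additivity of `U` in arrows becomes additivity in points. This is what
allows the tensor product, built from biadditive relations, to map to a colimit over the category of
elements. -/
lemma elementsι_add [U.Additive] {X : C} (x y : F.obj X) (u : U.obj (Opposite.op X)) :
    elementsι U F (x + y) u = elementsι U F x u + elementsι U F y u := by
  have h1 := map_fst_pair x y
  have h2 := map_snd_pair x y
  rw [← elementsι_map _ _ _ h1 u, ← elementsι_map _ _ _ h2 u,
    ← elementsι_map (biprod.fst + biprod.snd) _ _ (by rw [F.map_add]; exact congrArg₂ _ h1 h2) u,
    ← map_add, op_add, U.map_add]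
  rfl

/-- The map from `U ⊗_C F` to the colimit of the values of `U` on the elements of `F`. -/
def toElementsColimit (U : Cᵒᵖ ⥤ AddCommGrpCat.{u}) [U.Additive] (F : C ⥤ ModuleCat.{u} Rᵐᵒᵖ)
    [F.Additive] : CTensor U F →+ (colimit (elementsDiagram U F) : AddCommGrpCat.{u}) :=
  CTensor.lift (fun X => AddMonoidHom.mk'
      (fun u => AddMonoidHom.mk' (fun x => elementsι U F x u) (fun x y => elementsι_add x y u))
      (fun u v => by ext x; simp))
    (fun X Y t u x => elementsι_map t x _ rfl u)

lemma toElementsColimit_tmul [U.Additive] {X : C} (u : U.obj (Opposite.op X)) (x : F.obj X) :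
    toElementsColimit U F (CTensor.tmul u x) = elementsι U F x u := CTensor.lift_tmul _ _ u x

/-- Equality of rank one tensors. -/
lemma CTensor.tmul_eq_iff [U.Additive] (h : IsFlat F) {X Y : C} (u : U.obj (Opposite.op X))
    (x : F.obj X) (v : U.obj (Opposite.op Y)) (y : F.obj Y) :
    CTensor.tmul u x = CTensor.tmul v y ↔
      ∃ (W : C) (w : F.obj W) (p : W ⟶ X) (q : W ⟶ Y), F.map p w = x ∧ F.map q w = y ∧
        U.map p.op u = U.map q.op v := by
  constructor
  · intro e
    have : IsCofiltered (F ⋙ forget (ModuleCat.{u} Rᵐᵒᵖ)).Elements := h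
    -- Equal tensors have equal images in a filtered colimit, where equality of representatives is
    -- witnessed at a later stage. Only the map to the colimit is needed, not that it is an
    -- isomorphism.
    have e' : elementsι U F x u = elementsι U F y v := by
      rw [← toElementsColimit_tmul, e, toElementsColimit_tmul]
    obtain ⟨W, p, q, hpq⟩ := Concrete.colimit_exists_of_rep_eq (elementsDiagram U F) _ _ e'
    exact ⟨W.unop.1, W.unop.2, p.unop.1, q.unop.1, p.unop.2, q.unop.2, hpq⟩
  · rintro ⟨W, w, p, q, rfl, rfl, e⟩
    rw [← CTensor.map_tmul, ← CTensor.map_tmul, e]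

lemma CTensor.exists_of_tmul_eq_zero [U.Additive] (h : IsFlat F) {X : C}
    {u : U.obj (Opposite.op X)} {x : F.obj X} (e : CTensor.tmul u x = 0) :
    ∃ (W : C) (w : F.obj W) (p : W ⟶ X), F.map p w = x ∧ U.map p.op u = 0 := by
  have e0 : CTensor.tmul u x = CTensor.tmul (0 : U.obj (Opposite.op X)) x :=
    e.trans (CTensor.tmulLeft x).map_zero.symm
  obtain ⟨W, w, p, q, h1, -, h3⟩ := (CTensor.tmul_eq_iff h _ _ _ _).1 e0
  exact ⟨W, w, p, h1, h3.trans (map_zero _)⟩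

end RankOne

/-! ### Covering sieves, and when the Kan extension is conservative or faithful -/

section Sieves

attribute [local instance] hasBinaryBiproducts_of_finite_biproducts

variable {C : Type u} [SmallCategory C] [Preadditive C] [HasFiniteBiproducts C]
  {R : Type u} [Ring R] {F : C ⥤ ModuleCat.{u} Rᵐᵒᵖ}

/-- Finitely many elements in the image of a sieve lie in the image of one of its arrows. -/
lemma LinearSieve.exists_forall_mem {X : C} (S : LinearSieve X) (T : Finset (F.obj X))
    (h : ∀ x ∈ T, ∃ (Y : C) (s : Y ⟶ X) (y : F.obj Y), s ∈ S.arrows Y ∧ F.map s y = x) :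
    ∃ (Y : C) (s : Y ⟶ X), s ∈ S.arrows Y ∧ ∀ x ∈ T, ∃ y : F.obj Y, F.map s y = x := by
  classical
  induction T using Finset.induction_on with
  | empty => exact ⟨X, 0, zero_mem _, by simp⟩
  | insert a T _ ih =>
    obtain ⟨Y, s, hs, hY⟩ := ih fun x hx => h x (Finset.mem_insert_of_mem hx)
    obtain ⟨Z, t, z, ht, hz⟩ := h a (Finset.mem_insert_self a T)
    -- An additive sieve is closed under `biprod.desc`, which is a sum of composites with the two
    -- projections.
    refine ⟨Z ⊞ Y, biprod.desc t s, ?_, ?_⟩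
    · rw [biprod.desc_eq]
      exact add_mem (S.comp_mem _ ht) (S.comp_mem _ hs)
    · intro x hx
      rcases Finset.mem_insert.1 hx with rfl | hx
      · exact ⟨F.map biprod.inl z, by rw [map_comp_elem, biprod.inl_desc, hz]⟩
      · obtain ⟨y, hy⟩ := hY x hx
        exact ⟨F.map biprod.inr y, by rw [map_comp_elem, biprod.inr_desc, hy]⟩

lemma LinearSieve.exists_le_range {X : C} (S : LinearSieve X) (N : Submodule Rᵐᵒᵖ (F.obj X))
    (hN : N.FG)
    (h : ∀ x ∈ N, ∃ (Y : C) (s : Y ⟶ X) (y : F.obj Y), s ∈ S.arrows Y ∧ F.map s y = x) :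
    ∃ (Y : C) (s : Y ⟶ X), s ∈ S.arrows Y ∧ N ≤ LinearMap.range (F.map s).hom := by
  obtain ⟨T, rfl⟩ := hN
  obtain ⟨Y, s, hs, hY⟩ := S.exists_forall_mem T fun x hx => h x (Submodule.subset_span hx)
  exact ⟨Y, s, hs, Submodule.span_le.2 hY⟩

/-- Finite generation of `F X` reduces a joint surjection to a single one: generators are hit by
finitely many arrows, which a biproduct merges. -/
lemma LinearSieve.exists_surjective (hF : IsFGP F) {X : C} (S : LinearSieve X)
    (h : ∀ x : F.obj X, ∃ (Y : C) (s : Y ⟶ X) (y : F.obj Y), s ∈ S.arrows Y ∧ F.map s y = x) :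
    ∃ (Y : C) (s : Y ⟶ X), s ∈ S.arrows Y ∧ Function.Surjective (F.map s) := by
  obtain ⟨Y, s, hs, hY⟩ := S.exists_le_range ⊤ (hF X).1.fg_top fun x _ => h x
  exact ⟨Y, s, hs, fun x => hY (Submodule.mem_top (x := x))⟩

omit [SmallCategory C] [Preadditive C] [HasFiniteBiproducts C] in
/-- A surjection onto a projective module splits. -/
lemma exists_section_of_surjective {M N : ModuleCat.{u} Rᵐᵒᵖ} [Module.Projective Rᵐᵒᵖ N]
    (f : M ⟶ N) (hf : Function.Surjective f) : ∃ g : N ⟶ M, g ≫ f = 𝟙 N := by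
  obtain ⟨g, hg⟩ := Module.projective_lifting_property f.hom LinearMap.id hf
  exact ⟨ModuleCat.ofHom g, ModuleCat.hom_ext hg⟩

/-- The sieve of the arrows with target `X` along which `v ∈ V X` restricts into `W`. -/
def LinearSieve.restricting (V : Presheaf.{u} C) (W : ∀ Y : C, AddSubgroup (V.obj.obj (.op Y)))
    (hW : ∀ (Y Z : C) (g : Z ⟶ Y) (w : V.obj.obj (.op Y)), w ∈ W Y → V.obj.map g.op w ∈ W Z)
    {X : C} (v : V.obj.obj (.op X)) : LinearSieve X where
  arrows Y :=
    { carrier := {s | V.obj.map s.op v ∈ W Y}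
      add_mem' {s t} hs ht := by
        have := V.property
        have e : V.obj.map (s + t).op v = V.obj.map s.op v + V.obj.map t.op v := by
          rw [op_add, Functor.Additive.map_add]; rfl
        change V.obj.map (s + t).op v ∈ W Y
        rw [e]
        exact add_mem hs ht
      zero_mem' := by
        have := V.property
        have e : V.obj.map (0 : Y ⟶ X).op v = 0 := by
          rw [Limits.op_zero, V.obj.map_zero]; rfl
        change V.obj.map (0 : Y ⟶ X).op v ∈ W Y
        rw [e]
        exact zero_mem _
      neg_mem' {s} hs := by
        have := V.property
        have e : V.obj.map (-s).op v = -V.obj.map s.op v := by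
          rw [CategoryTheory.op_neg, Functor.map_neg]; rfl
        change V.obj.map (-s).op v ∈ W Y
        rw [e]
        exact neg_mem hs }
  comp_mem {Y Z} g s hs := by
    have e : V.obj.map (g ≫ s).op v = V.obj.map g.op (V.obj.map s.op v) := by simp
    change V.obj.map (g ≫ s).op v ∈ W Z
    rw [e]
    exact hW _ _ g _ hs

omit [HasFiniteBiproducts C] in
lemma LinearSieve.mem_restricting (V : Presheaf.{u} C)
    (W : ∀ Y : C, AddSubgroup (V.obj.obj (.op Y)))
    (hW : ∀ (Y Z : C) (g : Z ⟶ Y) (w : V.obj.obj (.op Y)), w ∈ W Y → V.obj.map g.op w ∈ W Z)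
    {X : C} (v : V.obj.obj (.op X)) {Y : C} (s : Y ⟶ X) :
    s ∈ (LinearSieve.restricting V W hW v).arrows Y ↔ V.obj.map s.op v ∈ W Y := Iff.rfl

variable (F) in
/-- Every jointly `F`-surjective sieve contains the identity. -/
def CoversTrivially : Prop :=
  ∀ ⦃X : C⦄ (S : LinearSieve X),
    (∀ x : F.obj X, ∃ (Y : C) (s : Y ⟶ X) (y : F.obj Y), s ∈ S.arrows Y ∧ F.map s y = x) →
    𝟙 X ∈ S.arrows X

omit [HasFiniteBiproducts C] in
lemma LinearSieve.eq_maximal_iff {X : C} (S : LinearSieve X) :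
    S = LinearSieve.maximal X ↔ 𝟙 X ∈ S.arrows X := by
  constructor
  · rintro rfl
    exact AddSubgroup.mem_top _
  · intro h
    ext Y s
    refine ⟨fun _ => AddSubgroup.mem_top _, fun _ => ?_⟩
    simpa using S.comp_mem s h

-- Since a sieve is maximal as soon as it contains the identity, and every topology contains the
-- coarsest one, only the identity has to be tested on each covering sieve.
omit [HasFiniteBiproducts C] in
lemma functorTopology_eq_coarsest_iff (h : IsFlat F) :
    functorTopology F h = LinearTopology.coarsest C ↔ CoversTrivially F := by
  constructor
  · intro e X S hS
    have hS' : S ∈ (functorTopology F h).covers X := hS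
    rw [e] at hS'
    exact S.eq_maximal_iff.1 hS'
  · intro hc
    ext X S
    refine ⟨fun hS => S.eq_maximal_iff.2 (hc S hS), ?_⟩
    intro hS
    exact LinearTopology.coarsest_le (functorTopology F h) X hS

/-- The sieve of the arrows factoring through `t`. -/
def LinearSieve.generate {X Y : C} (t : X ⟶ Y) : LinearSieve Y where
  arrows Z := (Preadditive.rightComp Z t).range
  comp_mem := by
    rintro Z W g _ ⟨s, rfl⟩
    exact ⟨g ≫ s, by simp [Preadditive.rightComp]⟩

/-- A covering sieve contains an arrow that `F` sends to a surjection onto a projective module, that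
is, to a split epimorphism; a section of the arrow itself puts the identity in the sieve. In the
other direction, if `F t` splits then the sieve of arrows factoring through `t` covers, and
factoring the identity through `t` is a section. -/
lemma reflects_isSplitEpi_iff_coversTrivially (hF : IsFGP F) :
    (∀ ⦃X Y : C⦄ (t : X ⟶ Y), IsSplitEpi (F.map t) → IsSplitEpi t) ↔ CoversTrivially F := by
  constructor
  · intro h X S hS
    obtain ⟨Y, s, hs, hsurj⟩ := S.exists_surjective hF hS
    have := (hF X).2
    obtain ⟨g, hg⟩ := exists_section_of_surjective (F.map s) hsurj
    have := h s ⟨⟨g, hg⟩⟩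
    rw [← IsSplitEpi.id s]
    exact S.comp_mem _ hs
  · intro h X Y t ht
    obtain ⟨r, hr⟩ := h (LinearSieve.generate t) fun y => ⟨X, t, section_ (F.map t) y,
      ⟨𝟙 X, by simp [Preadditive.rightComp]⟩, by
        rw [← ModuleCat.comp_apply, IsSplitEpi.id]; rfl⟩
    exact ⟨⟨r, hr⟩⟩

variable [F.Additive]

/-- The vanishing of `u ⊗ x` means that `u` restricts to zero along an arrow hitting `x`. Hence the
arrows annihilating `u` form a covering sieve, which contains the identity. -/
lemma CoversTrivially.eq_zero (hc : CoversTrivially F) (hfl : IsFlat F) {U : Presheaf.{u} C} {X : C}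
    (u : U.obj.obj (.op X))
    (h : ∀ x : F.obj X, CTensor.tmul u x = 0) : u = 0 := by
  have := U.property
  have h1 := hc (LinearSieve.restricting U (fun _ => ⊥) (by simp) u) fun x => by
    obtain ⟨W, w, p, hp, hu⟩ := CTensor.exists_of_tmul_eq_zero hfl (h x)
    exact ⟨W, p, w, hu, hp⟩
  rw [LinearSieve.mem_restricting] at h1
  simpa using h1

lemma CoversTrivially.faithful (hc : CoversTrivially F) (hfl : IsFlat F) :
    (kanExtension F).Faithful where
  map_injective {U V α β} e := by
    ext X u
    refine sub_eq_zero.1 (hc.eq_zero hfl (U := V) (X := X.unop) _ fun x => ?_)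
    have := congrArg (fun f => f.hom (CTensor.tmul (X := X.unop) u x)) e
    change CTensor.map α.hom (CTensor.tmul u x) = CTensor.map β.hom (CTensor.tmul u x) at this
    rw [CTensor.map_apply_tmul, CTensor.map_apply_tmul] at this
    exact ((CTensor.tmulLeft (U := V.obj) x).map_sub _ _).trans (sub_eq_zero.2 this)

/-- The quotient of the representable presheaf `C(-, X)` by a sieve. -/
def LinearSieve.quotient {X : C} (S : LinearSieve X) : Presheaf.{u} C :=
  ⟨{ obj Y := AddCommGrpCat.of ((Y.unop ⟶ X) ⧸ S.arrows Y.unop)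
     map {Y Z} f := AddCommGrpCat.ofHom (QuotientAddGroup.map _ _
       (Preadditive.leftComp X f.unop) (fun _ hs => S.comp_mem f.unop hs))
     map_id Y := by
       ext z
       exact congrArg QuotientAddGroup.mk (Category.id_comp z)
     map_comp f g := by
       ext z
       exact congrArg QuotientAddGroup.mk (Category.assoc g.unop f.unop z) },
   { map_add {Y Z f g} := by
       ext z
       exact congrArg QuotientAddGroup.mk (Preadditive.add_comp _ _ _ f.unop g.unop z) }⟩

-- The presheaf `C(-, X) / S` is generated by the class `e` of the identity, and `e` dies along the
-- arrows of `S`. If `S` covers, every tensor `e ⊗ x` is therefore zero, so the identity and zero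
-- endomorphisms have the same image; faithfulness then gives `e = 0`, that is, `𝟙 X` lies in `S`.
omit [HasFiniteBiproducts C] [F.Additive] in
lemma coversTrivially_of_faithful [(kanExtension F).Faithful] : CoversTrivially F := by
  intro X S hS
  let V := S.quotient
  have h0 : ∀ z : CTensor V.obj F, z = 0 := fun z => by
    refine CTensor.hom_congr (AddMonoidHom.id _) 0 (fun Y v y => ?_) z
    obtain ⟨f, rfl⟩ := QuotientAddGroup.mk_surjective v
    let e : V.obj.obj (.op X) := (QuotientAddGroup.mk (𝟙 X) : (X ⟶ X) ⧸ S.arrows X)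
    have hmap : ∀ {Z : C} (g : Z ⟶ X), V.obj.map g.op e =
        (QuotientAddGroup.mk g : (Z ⟶ X) ⧸ S.arrows Z) := fun g =>
      congrArg QuotientAddGroup.mk (Category.comp_id g)
    obtain ⟨Z, s, z, hs, hz⟩ := hS (F.map f y)
    have hs0 : V.obj.map s.op e = 0 :=
      (hmap s).trans ((QuotientAddGroup.eq_zero_iff s).2 hs)
    change CTensor.tmul _ y = 0
    -- The class of `f` is `e` restricted along `f`, so the tensor equals `e ⊗ F(f)(y) = e ⊗
    -- F(s)(z)`, and moving `s` back annihilates `e`.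
    refine (congrArg (fun v => CTensor.tmul v y) (hmap f).symm).trans ?_
    rw [CTensor.map_tmul, ← hz, ← CTensor.map_tmul, hs0]
    exact (CTensor.tmulLeft z).map_zero
  have hid : 𝟙 V = 0 := (kanExtension F).map_injective
    (ModuleCat.hom_ext (LinearMap.ext fun z => (h0 _).trans (h0 _).symm))
  have := congrArg (fun φ : V ⟶ V => φ.hom.app (.op X)
    (QuotientAddGroup.mk (𝟙 X) : (X ⟶ X) ⧸ S.arrows X)) hid
  exact (QuotientAddGroup.eq_zero_iff (𝟙 X)).1 this

/-- Bijectivity is checked objectwise. Injectivity comes from `CoversTrivially.eq_zero`; for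
surjectivity, the arrows along which `v` restricts into the image of `α` form a covering sieve. -/
lemma CoversTrivially.reflectsIsomorphisms (hc : CoversTrivially F) (hfl : IsFlat F) :
    (kanExtension F).ReflectsIsomorphisms where
  reflects {U V} α h := by
    have hbij : Function.Bijective (CTensor.map (F := F) α.hom) :=
      (ConcreteCategory.isIso_iff_bijective ((kanExtension F).map α)).1 h
    have := V.property
    have : IsIso α.hom := by
      rw [NatTrans.isIso_iff_isIso_app]
      rintro ⟨X⟩
      rw [ConcreteCategory.isIso_iff_bijective]
      constructor
      · refine (injective_iff_map_eq_zero (α.hom.app (.op X)).hom).2 fun u hu => ?_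
        refine hc.eq_zero hfl u fun x => hbij.1 ?_
        rw [CTensor.map_apply_tmul, map_zero]
        exact (congrArg (fun v => CTensor.tmul v x) hu).trans (CTensor.tmulLeft x).map_zero
      · intro v
        have h1 := hc (LinearSieve.restricting V
          (fun Y => (α.hom.app (.op Y)).hom.range) (by
            rintro Y Z g _ ⟨u, rfl⟩
            exact ⟨U.obj.map g.op u, NatTrans.naturality_apply α.hom g.op u⟩) v) fun x => by
          obtain ⟨z, hz⟩ := hbij.2 (CTensor.tmul v x)
          obtain ⟨Y, u, y, rfl⟩ := CTensor.exists_tmul z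
          rw [CTensor.map_apply_tmul] at hz
          -- A preimage `u ⊗ y` of `v ⊗ x` shows that `v` agrees with `α(u)` after restriction along
          -- `q` and `p`, and `q` hits `x`.
          obtain ⟨W, w, p, q, -, hq, e⟩ := (CTensor.tmul_eq_iff hfl _ _ _ _).1 hz
          refine ⟨W, q, w, ?_, hq⟩
          rw [LinearSieve.mem_restricting, ← e]
          exact ⟨U.obj.map p.op u, NatTrans.naturality_apply α.hom p.op u⟩
        rw [LinearSieve.mem_restricting] at h1
        obtain ⟨u, hu⟩ := h1
        exact ⟨u, hu.trans (by simp)⟩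
    have : IsIso ((ObjectProperty.ι _).map α) := this
    exact isIso_of_reflects_iso α (ObjectProperty.ι _)

end Sieves

/-! ### Comodules as tensors over `C`: the counit of `K ⊣ L` is invertible -/

section Counit

variable {C : Type u} [SmallCategory C] [Preadditive C] {R : Type u} [Ring R]
  {F : C ⥤ ModuleCat.{u} Rᵐᵒᵖ} [F.Additive] (hF : IsFGP F)

variable (F) in
/-- The presheaf `Hom_R(F -, M)`. -/
abbrev homPresheaf (M : ModuleCat.{u} Rᵐᵒᵖ) : Presheaf.{u} C := (restrictedYoneda F).obj M

/-- The rank one tensor `a ⊗ x` in `Hom_R(F -, M) ⊗_C F`. -/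
def htmul {M : ModuleCat.{u} Rᵐᵒᵖ} {X : C} (a : F.obj X →ₗ[Rᵐᵒᵖ] M) (x : F.obj X) :
    CTensor (homPresheaf F M).obj F :=
  CTensor.tmul (U := (homPresheaf F M).obj) (ModuleCat.ofHom a : F.obj X ⟶ M) x

/-- `a ↦ a ⊗ x` as an additive map. -/
def htmulLeft (M : ModuleCat.{u} Rᵐᵒᵖ) {X : C} (x : F.obj X) :
    (F.obj X →ₗ[Rᵐᵒᵖ] M) →+ CTensor (homPresheaf F M).obj F :=
  AddMonoidHom.mk' (fun a => htmul a x)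
    (fun a b => CTensor.add_tmul (U := (homPresheaf F M).obj)
      (ModuleCat.ofHom a : F.obj X ⟶ M) (ModuleCat.ofHom b : F.obj X ⟶ M) x)

lemma htmulLeft_apply (M : ModuleCat.{u} Rᵐᵒᵖ) {X : C} (a : F.obj X →ₗ[Rᵐᵒᵖ] M) (x : F.obj X) :
    htmulLeft M x a = htmul a x := rfl

lemma htmul_hom_congr {M : ModuleCat.{u} Rᵐᵒᵖ} {P : Type u} [AddCommGroup P]
    (f g : CTensor (homPresheaf F M).obj F →+ P)
    (h : ∀ (X : C) (a : F.obj X →ₗ[Rᵐᵒᵖ] M) (x : F.obj X), f (htmul a x) = g (htmul a x))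
    (z : CTensor (homPresheaf F M).obj F) : f z = g z :=
  CTensor.hom_congr f g (fun X a x => h X (ModuleCat.Hom.hom a) x) z

lemma exists_htmul [HasFiniteBiproducts C] {M : ModuleCat.{u} Rᵐᵒᵖ}
    (z : CTensor (homPresheaf F M).obj F) :
    ∃ (X : C) (a : F.obj X →ₗ[Rᵐᵒᵖ] M) (x : F.obj X), z = htmul a x := by
  obtain ⟨X, a, x, h⟩ := CTensor.exists_tmul z
  exact ⟨X, ModuleCat.Hom.hom a, x, h⟩

lemma exists_of_htmul_eq_zero [HasFiniteBiproducts C] (hfl : IsFlat F) {M : ModuleCat.{u} Rᵐᵒᵖ}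
    {X : C} {a : F.obj X →ₗ[Rᵐᵒᵖ] M} {x : F.obj X} (h : htmul a x = 0) :
    ∃ (W : C) (w : F.obj W) (p : W ⟶ X), F.map p w = x ∧ ∀ y, a (F.map p y) = 0 := by
  have := (homPresheaf F M).property
  obtain ⟨W, w, p, hp, e⟩ := CTensor.exists_of_tmul_eq_zero hfl h
  exact ⟨W, w, p, hp, fun y => congrArg (fun f : F.obj W ⟶ M => f.hom y) e⟩

/-- The map `Hom_R(F -, M) ⊗_C F → M ⊗_R (G ⊗_C F)`, `a ⊗ x ↦ ∑ i, a(xᵢ) ⊗ (fᵢ ⊗ x)`. -/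
def homTensorMap (M : ModuleCat.{u} Rᵐᵒᵖ) :
    CTensor (homPresheaf F M).obj F →ₗ[Rᵐᵒᵖ] BTensor R M (CoringCarrier F) :=
  CTensor.liftLinear (U := (homPresheaf F M).obj)
    (fun X => AddMonoidHom.mk' (fun a : F.obj X ⟶ M => coev hF a.hom)
      (fun a b : F.obj X ⟶ M => by
        ext x
        change coev hF (a.hom + b.hom) x = coev hF a.hom x + coev hF b.hom x
        simp [coev_apply, BTensor.add_tmul, Finset.sum_add_distrib]))
    (fun _ _ t u x => coev_comp hF t (ModuleCat.Hom.hom u) x)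

lemma homTensorMap_htmul {M : ModuleCat.{u} Rᵐᵒᵖ} {X : C} (a : F.obj X →ₗ[Rᵐᵒᵖ] M)
    (x : F.obj X) : homTensorMap hF M (htmul a x) = coev hF a x :=
  CTensor.liftLinear_tmul (U := (homPresheaf F M).obj) _ _ _ x

/-- The homomorphism `x ↦ m · g(x)`. -/
def rankOneHom {M N : Type u} [AddCommGroup M] [Module Rᵐᵒᵖ M] [AddCommGroup N] [Module Rᵐᵒᵖ N]
    (m : M) (g : N →ₗ[Rᵐᵒᵖ] R) : N →ₗ[Rᵐᵒᵖ] M where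
  toFun x := op (g x) • m
  map_add' x y := by simp [add_smul]
  map_smul' r x := by
    induction r using MulOpposite.rec' with
    | h r => simp [mul_smul]

/-- The map of presheaves `g ↦ m · g(-)`. -/
def rankOnePresheafHom (M : ModuleCat.{u} Rᵐᵒᵖ) (m : M) :
    (dualPresheaf F).obj ⟶ (homPresheaf F M).obj where
  app X := AddCommGrpCat.ofHom (AddMonoidHom.mk'
    (fun g : F.obj X.unop →ₗ[Rᵐᵒᵖ] R => (ModuleCat.ofHom (rankOneHom m g) : F.obj X.unop ⟶ M))
    (fun g g' => by
      ext x
      exact congrArg (· • m) (op_add (g x) (g' x)) |>.trans (add_smul _ _ _)))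
  naturality _ _ _ := rfl

/-- The inverse `m ⊗ (g ⊗ x) ↦ m · g(-) ⊗ x` of `homTensorMap`. -/
def homTensorInv (M : ModuleCat.{u} Rᵐᵒᵖ) :
    BTensor R M (CoringCarrier F) →+ CTensor (homPresheaf F M).obj F :=
  BTensor.lift (AddMonoidHom.mk'
      (fun m => (CTensor.map (F := F) (rankOnePresheafHom M m)).toAddMonoidHom)
      (fun m m' => by
        ext z
        refine CTensor.hom_congr (CTensor.map (rankOnePresheafHom M (m + m'))).toAddMonoidHom
          ((CTensor.map (rankOnePresheafHom M m)).toAddMonoidHom +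
            (CTensor.map (rankOnePresheafHom M m')).toAddMonoidHom) (fun X g x => ?_) z
        simp only [LinearMap.toAddMonoidHom_coe, AddMonoidHom.add_apply, CTensor.map_apply_tmul,
          ← CTensor.add_tmul]
        congr 1
        refine ModuleCat.hom_ext (LinearMap.ext fun y => ?_)
        exact smul_add _ m m'))
    (fun r m z => by
      refine CTensor.hom_congr (CTensor.map (rankOnePresheafHom M (op r • m))).toAddMonoidHom
          ((CTensor.map (rankOnePresheafHom M m)).toAddMonoidHom.comp
            (dAct F r).toAddMonoidHom) (fun X g x => ?_) z
      simp only [LinearMap.toAddMonoidHom_coe, AddMonoidHom.comp_apply]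
      refine (CTensor.map_apply_tmul _ _ _).trans
        (Eq.trans ?_ (congrArg _ (dAct_dtmul F r g x)).symm)
      refine Eq.trans ?_ (CTensor.map_apply_tmul _ _ _).symm
      congr 1
      refine ModuleCat.hom_ext (LinearMap.ext fun y => ?_)
      exact smul_smul _ _ m)

lemma homTensorInv_tmul (M : ModuleCat.{u} Rᵐᵒᵖ) (m : M) {X : C} (g : F.obj X →ₗ[Rᵐᵒᵖ] R)
    (x : F.obj X) :
    homTensorInv M (BTensor.tmul R m (dtmul F g x)) = htmul (rankOneHom m g) x :=
  CTensor.map_apply_tmul (rankOnePresheafHom M m) _ x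

/-- The dual basis expands a linear map as the sum of the rank one maps `a(xᵢ) · fᵢ(-)`. -/
lemma homTensorInv_homTensorMap (M : ModuleCat.{u} Rᵐᵒᵖ) (z : CTensor (homPresheaf F M).obj F) :
    homTensorInv M (homTensorMap hF M z) = z := by
  refine htmul_hom_congr ((homTensorInv M).comp (homTensorMap hF M).toAddMonoidHom)
    (AddMonoidHom.id _) (fun X a x => ?_) z
  refine (congrArg (homTensorInv M) (homTensorMap_htmul hF a x)).trans ?_
  rw [coev_apply, map_sum]
  simp only [homTensorInv_tmul, ← htmulLeft_apply]
  rw [← map_sum, AddMonoidHom.id_apply]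
  congr 1
  ext y
  rw [LinearMap.sum_apply]
  conv_rhs => rw [← (dualBasis hF X).sum_smul y, map_sum]
  exact Finset.sum_congr rfl fun i _ => (a.map_smul _ _).symm

/-- The scalars `g(xᵢ)` move across the balanced tensor, and `∑ i, g(xᵢ) · fᵢ = g`. -/
lemma homTensorMap_homTensorInv (M : ModuleCat.{u} Rᵐᵒᵖ) (z : BTensor R M (CoringCarrier F)) :
    homTensorMap hF M (homTensorInv M z) = z := by
  refine BTensor.hom_congr ((homTensorMap hF M).toAddMonoidHom.comp (homTensorInv M))
    (AddMonoidHom.id _) (fun m h => ?_) z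
  refine dtmul_hom_congr F (((homTensorMap hF M).toAddMonoidHom.comp (homTensorInv M)).comp
    (BTensor.tmulRight R m)) (BTensor.tmulRight R m) (fun X g x => ?_) h
  refine (congrArg (homTensorMap hF M) (homTensorInv_tmul M m g x)).trans ?_
  rw [homTensorMap_htmul, coev_apply]
  change ∑ i, BTensor.tmul R (op (g ((dualBasis hF X).x i)) • m) _ =
    BTensor.tmul R m (dtmul F g x)
  simp only [BTensor.op_smul_tmul, smul_dtmul_left]
  rw [← BTensor.tmul_sum, ← dtmul_sum_left]
  congr 2
  ext y
  conv_rhs => rw [← (dualBasis hF X).sum_smul y, map_sum]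
  simp

lemma homTensorMap_injective (M : ModuleCat.{u} Rᵐᵒᵖ) :
    Function.Injective (homTensorMap hF M) :=
  Function.LeftInverse.injective (homTensorInv_homTensorMap hF M)

variable {hF}

/-- Iterating the coevaluation amounts to comultiplying. -/
lemma comulMap_coev (M : ModuleCat.{u} Rᵐᵒᵖ) {X : C} (a : F.obj X →ₗ[Rᵐᵒᵖ] M) (x : F.obj X) :
    (coring hF).comulMap M (coev hF a x) = coev hF (coev hF a) x := by
  have e : ∀ i, (coring hF).comulMap M
      (BTensor.tmul R (a ((dualBasis hF X).x i)) (dtmul F ((dualBasis hF X).f i) x)) =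
      ∑ j, BTensor.tmul R (BTensor.tmul R (a ((dualBasis hF X).x i))
        (dtmul F ((dualBasis hF X).f i) ((dualBasis hF X).x j)))
        (dtmul F ((dualBasis hF X).f j) x) := fun i => by
    refine ((coring hF).comulMap_tmul _ _).trans ?_
    refine (congrArg _ (comulHom_dtmul hF _ x)).trans ?_
    rw [coev_apply]
    exact map_sum ((coring hF).tensorMap ((coring hF).insertMap _)) _ _
  rw [coev_apply, coev_apply]
  refine (map_sum ((coring hF).comulMap M) _ _).trans ?_
  refine (Finset.sum_congr rfl fun i _ => e i).trans ?_
  refine Finset.sum_comm.trans (Finset.sum_congr rfl fun j _ => ?_)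
  rw [coev_apply, BTensor.sum_tmul]
  rfl

lemma tensorMap_coev {M N : ModuleCat.{u} Rᵐᵒᵖ} {X : C} (b : M →ₗ[Rᵐᵒᵖ] N)
    (a : F.obj X →ₗ[Rᵐᵒᵖ] M) (x : F.obj X) :
    (coring hF).tensorMap b (coev hF a x) = coev hF (b.comp a) x := by
  rw [coev_apply, coev_apply]
  refine (map_sum ((coring hF).tensorMap b) _ _).trans ?_
  exact Finset.sum_congr rfl fun i _ => (coring hF).tensorMap_tmul _ _ _

/-- A homomorphism `k X → M` of comodules from a linear map. -/
def homOfLinear {X : C} {M : (coring hF).Comodule} (a : F.obj X →ₗ[Rᵐᵒᵖ] M.A)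
    (h : ∀ x, coaction M (a x) = coev hF a x) : (comoduleFunctor hF).obj X ⟶ M :=
  { f := ModuleCat.ofHom a
    h := ModuleCat.hom_ext (LinearMap.ext fun x =>
      (tensorMap_coev a LinearMap.id x).trans (h x).symm) }

lemma counit_coev {M : ModuleCat.{u} Rᵐᵒᵖ} {X : C} (a : F.obj X →ₗ[Rᵐᵒᵖ] M) (x : F.obj X) :
    (coring hF).counitMap M (coev hF a x) = a x := by
  rw [coev_apply]
  refine (map_sum ((coring hF).counitMap M) _ _).trans ?_
  refine (Finset.sum_congr rfl fun i _ => (coring hF).counitMap_tmul _ _).trans ?_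
  conv_rhs => rw [← (dualBasis hF X).sum_smul x, map_sum]
  refine Finset.sum_congr rfl fun i _ => ?_
  rw [map_smul]
  exact congrArg (fun r => op r • a ((dualBasis hF X).x i)) (counitHom_dtmul _ x)

lemma counitMap_coaction (M : (coring hF).Comodule) (m : M.A) :
    (coring hF).counitMap M.A (coaction M m) = m :=
  LinearMap.congr_fun (congrArg ModuleCat.Hom.hom M.counit) m

lemma comulMap_coaction (M : (coring hF).Comodule) (m : M.A) :
    (coring hF).comulMap M.A (coaction M m) =
      (coring hF).tensorMap (coaction M) (coaction M m) :=
  LinearMap.congr_fun (congrArg ModuleCat.Hom.hom M.coassoc) m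

/-- If `φ(x) = 0` for a homomorphism `φ : k X → M` of comodules, then `x` comes from an arrow
annihilated by `φ`. -/
lemma exists_of_homLinear_eq_zero [HasFiniteBiproducts C] (hfl : IsFlat F)
    {M : (coring hF).Comodule} {X : C} (φ : (comoduleFunctor hF).obj X ⟶ M) (x : F.obj X) (h : homLinear φ x = 0) :
    ∃ (W : C) (w : F.obj W) (p : W ⟶ X), F.map p w = x ∧ (comoduleFunctor hF).map p ≫ φ = 0 := by
  -- Because `φ` is a comodule homomorphism, `φ ⊗ x` corresponds to the coaction of `φ(x)` in `M ⊗_R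
  -- H`.
  have h0 : htmul (homLinear φ) x = 0 := homTensorMap_injective hF M.A <| by
    rw [homTensorMap_htmul, map_zero, ← coaction_homLinear, h, map_zero]
  obtain ⟨W, w, p, hp, e⟩ := exists_of_htmul_eq_zero hfl h0
  exact ⟨W, w, p, hp, Comonad.Coalgebra.Hom.ext (ModuleCat.hom_ext (LinearMap.ext e))⟩

/-- Every element of a comodule `M` is of the form `φ(x)` for a homomorphism `φ : k X → M`. -/
lemma exists_homLinear_eq [HasFiniteBiproducts C] (hfl : IsFlat F) (M : (coring hF).Comodule)
    (m : M.A) :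
    ∃ (X : C) (φ : (comoduleFunctor hF).obj X ⟶ M) (x : F.obj X), homLinear φ x = m := by
  -- The coaction of `m` is represented by one tensor `a ⊗ x`. The counit axiom will give `a(x) =
  -- m`, but `a` is so far only linear.
  obtain ⟨X, a, x, hz⟩ := exists_htmul (homTensorInv M.A (coaction M m))
  have h1 : coaction M m = coev hF a x := by
    rw [← homTensorMap_homTensorInv hF M.A (coaction M m), hz, homTensorMap_htmul]
  have h2 : a x = m := by
    rw [← counit_coev (hF := hF), ← h1, counitMap_coaction]
  let N : ModuleCat.{u} Rᵐᵒᵖ := ModuleCat.of Rᵐᵒᵖ (BTensor R M.A (CoringCarrier F))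
  -- The maps `b` and `c` are the two sides of the comodule condition on `a`. Coassociativity at `m`
  -- says that `b ⊗ x = c ⊗ x`, so by flatness they agree after restriction along some `p` through
  -- which `x` factors.
  let b : F.obj X →ₗ[Rᵐᵒᵖ] N := coev hF a
  let c : F.obj X →ₗ[Rᵐᵒᵖ] N := (coaction M).comp a
  have h3 : coev hF b x = coev hF c x := by
    have e := comulMap_coaction M m
    rw [h1] at e
    exact (comulMap_coev M.A a x).symm.trans (e.trans (tensorMap_coev (N := N) (coaction M) a x))
  have h4 : htmul (b - c) x = 0 := by
    rw [← htmulLeft_apply, map_sub, sub_eq_zero]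
    refine homTensorMap_injective hF N ?_
    exact (homTensorMap_htmul hF b x).trans (h3.trans (homTensorMap_htmul hF c x).symm)
  obtain ⟨W, w, p, hp, e⟩ := exists_of_htmul_eq_zero hfl h4
  refine ⟨W, homOfLinear (a.comp (F.map p).hom) fun y => ?_, w, ?_⟩
  · rw [coev_comp]
    exact (sub_eq_zero.1 (e y)).symm
  · change a (F.map p w) = m
    rw [hp, h2]

/-- The counit of `K ⊣ L` is `φ ⊗ x ↦ φ(x)`. -/
lemma comparisonAdjunction_counit_tmul (M : (coring hF).Comodule) {X : C}
    (φ : (comoduleFunctor hF).obj X ⟶ M) (x : F.obj X) :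
    ((comparisonAdjunction hF).counit.app M).f.hom
      (CTensor.tmul (U := ((comparisonRight hF).obj M).obj) φ x) = homLinear φ x :=
  transposeLeft_tmul (𝟙 ((comparisonRight hF).obj M)) φ x

/-- Evaluation `φ ⊗ x ↦ φ(x)` is onto by `exists_homLinear_eq`. If `φ(x) = 0`, then `x = F(p)(w)`
with `φ` annihilated by `p`, and moving `p` across the tensor gives `φ ⊗ x = 0`. -/
lemma bijective_counit [HasFiniteBiproducts C] (hfl : IsFlat F) (M : (coring hF).Comodule) :
    Function.Bijective ((comparisonAdjunction hF).counit.app M).f.hom := by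
  constructor
  · refine (injective_iff_map_eq_zero _).2 fun z hz => ?_
    obtain ⟨X, φ, x, rfl⟩ := CTensor.exists_tmul z
    have e := (comparisonAdjunction_counit_tmul M φ x).symm.trans hz
    obtain ⟨W, w, p, rfl, hp⟩ := exists_of_homLinear_eq_zero hfl φ x e
    refine (CTensor.map_tmul (U := ((comparisonRight hF).obj M).obj) p φ w).symm.trans ?_
    refine (congrArg (fun ψ => CTensor.tmul (U := ((comparisonRight hF).obj M).obj) ψ w)
      hp).trans ?_
    exact (CTensor.tmulLeft (U := ((comparisonRight hF).obj M).obj) w).map_zero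
  · intro m
    obtain ⟨X, φ, x, rfl⟩ := exists_homLinear_eq hfl M m
    exact ⟨_, comparisonAdjunction_counit_tmul M φ x⟩

lemma isIso_counit [HasFiniteBiproducts C] (hfl : IsFlat F) (M : (coring hF).Comodule) :
    IsIso ((comparisonAdjunction hF).counit.app M) := by
  have : IsIso ((coring hF).comonad.forget.map ((comparisonAdjunction hF).counit.app M)) :=
    (ConcreteCategory.isIso_iff_bijective _).2 (bijective_counit hfl M)
  exact isIso_of_reflects_iso _ (coring hF).comonad.forget

end Counit

/-! ### The category `C` recovered as the finitely generated projective comodules -/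

section Comodules

attribute [local instance] hasBinaryBiproducts_of_finite_biproducts

/-- A homomorphism `f : M → N` is von Neumann regular if its range is the kernel of a surjection
and `N` is projective. -/
lemma exists_regular_of_exact {R : Type u} [Ring R] {M N P : ModuleCat.{u} Rᵐᵒᵖ}
    [Module.Projective Rᵐᵒᵖ N] [Module.Projective Rᵐᵒᵖ P] (f : M ⟶ N) (q : N ⟶ P)
    (hq : Function.Surjective q) (hfq : ∀ y, q y = 0 ↔ ∃ x, f x = y) :
    ∃ v : N ⟶ M, f ≫ v ≫ f = f := by
  obtain ⟨σ, hσ⟩ := exists_section_of_surjective q hq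
  have h1 : ∀ y, q.hom (σ.hom y) = y := fun y => congrArg (fun g => g.hom y) hσ
  -- Subtracting `σ q` projects `N` onto the kernel of `q`, which is the range of `f`. Projectivity
  -- of `N` lifts this projection through `f` to the quasi-inverse `v`.
  let π : N →ₗ[Rᵐᵒᵖ] LinearMap.range f.hom :=
    LinearMap.codRestrict _ (LinearMap.id - σ.hom.comp q.hom) fun y => (hfq _).1 (by
      change q.hom (y - σ.hom (q.hom y)) = 0
      rw [map_sub, h1, sub_self])
  obtain ⟨v, hv⟩ := Module.projective_lifting_property f.hom.rangeRestrict π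
    f.hom.surjective_rangeRestrict
  refine ⟨ModuleCat.ofHom v, ModuleCat.hom_ext (LinearMap.ext fun x => ?_)⟩
  have h2 : f.hom (v (f.hom x)) = f.hom x - σ.hom (q.hom (f.hom x)) :=
    congrArg Subtype.val (LinearMap.congr_fun hv (f.hom x))
  have h3 : q.hom (f.hom x) = 0 := (hfq _).2 ⟨x, rfl⟩
  change f.hom (v (f.hom x)) = f.hom x
  rw [h2, h3, map_zero, sub_zero]

variable {C : Type u} [SmallCategory C] [Preadditive C] {R : Type u} [Ring R]
  {F : C ⥤ ModuleCat.{u} Rᵐᵒᵖ} [F.Additive]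

/-- If `F t` is the kernel of a surjection `q` onto a projective module, then the cokernel of `t`
exists, and `F` sends it to `q`. -/
lemma IsFiberFunctor.exists_cokernel (hF : IsFiberFunctor F) {X Y : C} (t : X ⟶ Y)
    {P : ModuleCat.{u} Rᵐᵒᵖ} [Module.Projective Rᵐᵒᵖ P] (q : F.obj Y ⟶ P)
    (hq : Function.Surjective q) (hfq : ∀ y, q y = 0 ↔ ∃ x, F.map t x = y) :
    ∃ (Q : C) (c : Y ⟶ Q) (d : F.obj Q ≅ P),
      (∀ (Z : C) (g : Y ⟶ Z), t ≫ g = 0 → ∃ h, c ≫ h = g) ∧ F.map c ≫ d.hom = q := by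
  have := (hF.fgp Y).2
  have hr := exists_regular_of_exact (F.map t) q hq hfq
  have := hF.hasCokernel t hr
  have := hF.preservesCokernel t hr
  let L := CokernelCofork.mapIsColimit _ (cokernelIsCokernel t) F
  have hw : F.map t ≫ q = 0 := ModuleCat.hom_ext (LinearMap.ext fun x => (hfq _).2 ⟨x, rfl⟩)
  let d : F.obj (cokernel t) ⟶ P := L.desc (CokernelCofork.ofπ q hw)
  have hd : F.map (cokernel.π t) ≫ d = q := L.fac (CokernelCofork.ofπ q hw) .one
  have hepi : Epi (F.map (cokernel.π t)) := Cofork.IsColimit.epi L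
  have hsurj := (ModuleCat.epi_iff_surjective _).1 hepi
  have hd' : ∀ y, d (F.map (cokernel.π t) y) = q y := fun y => congrArg (fun g => g.hom y) hd
  -- Both `F (cokernel t)` and `P` are the quotient of `F Y` by the range of `F t`.
  have : IsIso d := by
    rw [ConcreteCategory.isIso_iff_bijective]
    constructor
    · refine (injective_iff_map_eq_zero d.hom).2 fun z hz => ?_
      obtain ⟨y, rfl⟩ := hsurj z
      obtain ⟨x, rfl⟩ := (hfq y).1 ((hd' y).symm.trans hz)
      rw [map_comp_elem, cokernel.condition, F.map_zero]
      rfl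
    · intro p
      obtain ⟨y, rfl⟩ := hq p
      exact ⟨_, hd' y⟩
  exact ⟨cokernel t, cokernel.π t, asIso d, fun Z g hg => ⟨cokernel.desc t g hg, by simp⟩, hd⟩

variable [HasFiniteBiproducts C]

omit [HasFiniteBiproducts C] in
/-- A flat functor preserves kernels. -/
lemma IsFlat.exists_kernel (hfl : IsFlat F) {X Y : C} (s : X ⟶ Y) [HasKernel s] (x : F.obj X)
    (hx : F.map s x = 0) : ∃ y, F.map (kernel.ι s) y = x := by
  -- A point where `s` and `0` agree comes from an arrow `p` equalizing them, and `p` factors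
  -- through the kernel.
  obtain ⟨W, w, p, rfl, hp⟩ := hfl.exists_equalizing s 0 x (by rw [hx, F.map_zero]; rfl)
  rw [comp_zero] at hp
  exact ⟨F.map (kernel.lift s p hp) w, by rw [map_comp_elem, kernel.lift_ι]⟩

/-- Every homomorphism `k X → k Y` of comodules comes from `C`. -/
lemma IsFiberFunctor.full (hF : IsFiberFunctor F) : (comoduleFunctor hF.fgp).Full where
  map_surjective {X Y} a := by
    let k := comoduleFunctor hF.fgp
    have := hF.faithful
    have := hF.reflectsIsomorphisms
    -- The arrows along which `a` becomes a homomorphism coming from `C`. Once this sieve is known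
    -- to cover, `a` is descended along one of its arrows.
    let S : LinearSieve X :=
      { arrows Z :=
          { carrier := {s | ∃ g : Z ⟶ Y, k.map g = k.map s ≫ a}
            add_mem' := by
              rintro s t ⟨g, hg⟩ ⟨g', hg'⟩
              exact ⟨g + g', by rw [k.map_add, hg, hg', k.map_add, Preadditive.add_comp]⟩
            zero_mem' := ⟨0, by rw [k.map_zero, k.map_zero, zero_comp]⟩
            neg_mem' := by
              rintro s ⟨g, hg⟩
              exact ⟨-g, by rw [k.map_neg, hg, k.map_neg, Preadditive.neg_comp]⟩ }
        comp_mem := by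
          rintro Z W h s ⟨g, hg⟩
          exact ⟨h ≫ g, by rw [k.map_comp, hg, k.map_comp, Category.assoc]⟩ }
    obtain ⟨Z, s, ⟨g, hg⟩, hs⟩ := S.exists_surjective hF.fgp fun x => by
      -- This homomorphism vanishes exactly on the graph of `a`. An arrow `p` annihilating it and
      -- hitting `(x, a(x))` has components `s`, `g` with `k(g) = k(s) ≫ a`.
      let φ : k.obj (X ⊞ Y) ⟶ k.obj Y := k.map biprod.fst ≫ a - k.map biprod.snd
      let y : F.obj Y := homLinear a x
      have hφ : homLinear φ (F.map biprod.inl x + F.map biprod.inr y) = 0 := by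
        exact (congrArg₂ (fun v w : F.obj Y => v - w)
          (congrArg (homLinear a) (map_fst_pair x y)) (map_snd_pair x y)).trans (sub_self y)
      obtain ⟨W, w, p, hp, e⟩ := exists_of_homLinear_eq_zero hF.flat φ _ hφ
      refine ⟨W, p ≫ biprod.fst, w, ⟨p ≫ biprod.snd, ?_⟩, ?_⟩
      · rw [Preadditive.comp_sub, sub_eq_zero] at e
        rw [k.map_comp, k.map_comp, Category.assoc]
        exact e.symm
      · rw [← map_comp_elem, hp, map_fst_pair]
    have hepi : Epi (F.map s) := (ModuleCat.epi_iff_surjective _).2 hs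
    have := hF.hasKernel s hepi
    have := (hF.fgp X).2
    obtain ⟨Q, c, d, hc, hd⟩ := hF.exists_cokernel (kernel.ι s) (F.map s) hs fun z =>
      ⟨hF.flat.exists_kernel s z, by
        rintro ⟨n, rfl⟩
        rw [map_comp_elem, kernel.condition, F.map_zero]
        rfl⟩
    -- Here `j` compares the cokernel of the kernel of `s` with `X`. It is inverted by `F`, hence
    -- invertible, so `s` is the cokernel of its kernel.
    obtain ⟨j, hj⟩ := hc X s (kernel.condition s)
    have hcepi : Epi (F.map c) := by
      have : Epi (F.map c ≫ d.hom) := hd ▸ hepi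
      rw [← Iso.eq_comp_inv] at hd
      rw [hd]
      infer_instance
    have hjd : F.map j = d.hom := by
      rw [← cancel_epi (F.map c), ← F.map_comp, hj, hd]
    have : IsIso (F.map j) := by rw [hjd]; infer_instance
    have : IsIso j := isIso_of_reflects_iso j F
    let a' : F.obj X ⟶ F.obj Y := a.f
    have hg' : F.map g = F.map s ≫ a' := congrArg Comonad.Coalgebra.Hom.f hg
    -- Since `F g = F s ≫ a'`, faithfulness of `F` shows that `g` kills the kernel of `s`; it
    -- therefore factors through `c`.
    obtain ⟨h, hh⟩ := hc Y g (F.map_injective (by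
      rw [F.map_comp, hg', ← Category.assoc, ← F.map_comp, kernel.condition, F.map_zero,
        F.map_zero, zero_comp]))
    refine ⟨inv j ≫ h, Comonad.Coalgebra.Hom.ext ?_⟩
    change F.map (inv j ≫ h) = a'
    rw [← cancel_epi (F.map s), ← hg', ← F.map_comp, ← hj, Category.assoc,
      IsIso.hom_inv_id_assoc, hh]

/-- A comodule which is finitely generated over `R` is a quotient of some `k X`. -/
lemma exists_surjective_homLinear {hF : IsFGP F} (hfl : IsFlat F) (M : (coring hF).Comodule)
    [Module.Finite Rᵐᵒᵖ M.A] :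
    ∃ (X : C) (φ : (comoduleFunctor hF).obj X ⟶ M), Function.Surjective (homLinear φ) := by
  classical
  let k := comoduleFunctor hF
  have h : ∀ T : Finset M.A, ∃ (X : C) (φ : k.obj X ⟶ M), ∀ m ∈ T, ∃ x, homLinear φ x = m := by
    intro T
    induction T using Finset.induction_on with
    | empty =>
      obtain ⟨X, φ, -⟩ := exists_homLinear_eq hfl M 0
      exact ⟨X, φ, by simp⟩
    | insert m T _ ih =>
      obtain ⟨X, φ, hφ⟩ := ih
      obtain ⟨Y, ψ, y, hy⟩ := exists_homLinear_eq hfl M m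
      -- The homomorphism `(z, x) ↦ ψ(z) + φ(x)` has both images in its range.
      refine ⟨Y ⊞ X, k.map biprod.fst ≫ ψ + k.map biprod.snd ≫ φ, ?_⟩
      have e : ∀ (z : F.obj Y) (x : F.obj X),
          homLinear (k.map biprod.fst ≫ ψ + k.map biprod.snd ≫ φ)
            (F.map biprod.inl z + F.map biprod.inr x) = homLinear ψ z + homLinear φ x := by
        intro z x
        change homLinear ψ (F.map biprod.fst (F.map biprod.inl z + F.map biprod.inr x)) +
          homLinear φ (F.map biprod.snd (F.map biprod.inl z + F.map biprod.inr x)) = _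
        rw [map_fst_pair, map_snd_pair]
      intro n hn
      rcases Finset.mem_insert.1 hn with rfl | hn
      · exact ⟨_, (e y 0).trans (by rw [hy, map_zero, add_zero])⟩
      · obtain ⟨x, hx⟩ := hφ n hn
        exact ⟨_, (e 0 x).trans (by rw [hx, map_zero, zero_add])⟩
  obtain ⟨T, hT⟩ := (inferInstance : Module.Finite Rᵐᵒᵖ M.A).fg_top
  obtain ⟨X, φ, hφ⟩ := h T
  refine ⟨X, φ, LinearMap.range_eq_top.1 (top_le_iff.1 ?_)⟩
  rw [← hT]
  exact Submodule.span_le.2 hφ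

/-- Every comodule which is finitely generated projective over `R` is isomorphic to some `k X`. -/
lemma IsFiberFunctor.exists_iso (hF : IsFiberFunctor F) (M : (coring hF.fgp).Comodule)
    (hM : Module.Finite Rᵐᵒᵖ M.A ∧ Module.Projective Rᵐᵒᵖ M.A) :
    ∃ X : C, Nonempty ((comoduleFunctor hF.fgp).obj X ≅ M) := by
  obtain ⟨_, _⟩ := hM
  let k := comoduleFunctor hF.fgp
  obtain ⟨X, φ, hφ⟩ := exists_surjective_homLinear hF.flat M
  -- The arrows annihilated by `φ`; jointly their images under `F` fill the kernel of `φ`.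
  let S : LinearSieve X :=
    { arrows Z :=
        { carrier := {s | k.map s ≫ φ = 0}
          add_mem' {s t} hs ht := by
            change k.map (s + t) ≫ φ = 0
            rw [k.map_add, Preadditive.add_comp, hs, ht, add_zero]
          zero_mem' := by
            change k.map 0 ≫ φ = 0
            rw [k.map_zero, zero_comp]
          neg_mem' {s} hs := by
            change k.map (-s) ≫ φ = 0
            rw [k.map_neg, Preadditive.neg_comp, hs, neg_zero] }
      comp_mem {Z W} g s hs := by
        change k.map (g ≫ s) ≫ φ = 0
        rw [k.map_comp, Category.assoc, hs, comp_zero] }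
  have := (hF.fgp X).1
  -- Finite presentation makes the kernel of `φ` finitely generated, so a single arrow `t` of `S`
  -- covers it. The cokernel of `t` is then the object sought.
  have := Module.finitePresentation_of_projective Rᵐᵒᵖ M.A
  obtain ⟨Y, t, ht, hker⟩ := S.exists_le_range (LinearMap.ker (homLinear φ))
    (Module.FinitePresentation.fg_ker _ hφ) fun x hx => by
      obtain ⟨W, w, p, hp, e⟩ := exists_of_homLinear_eq_zero hF.flat φ x hx
      exact ⟨W, p, w, e, hp⟩
  obtain ⟨Q, c, d, -, hd⟩ := hF.exists_cokernel t φ.f hφ fun x =>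
    ⟨fun hx => hker hx, by
      rintro ⟨y, rfl⟩
      exact congrArg (fun ψ => homLinear ψ y) ht⟩
  have hd' : ∀ x, d.hom.hom (F.map c x) = homLinear φ x := fun x => congrArg (fun g => g.hom x) hd
  have hcsurj : Function.Surjective (F.map c) := fun z => by
    obtain ⟨x, hx⟩ := hφ (d.hom z)
    exact ⟨x, d.toLinearEquiv.injective ((hd' x).trans hx)⟩
  -- The comodule condition can be checked after the surjection `F c`, where it is the one for `φ`.
  let ψ : k.obj Q ⟶ M := homOfLinear d.hom.hom fun z => by
    obtain ⟨x, rfl⟩ := hcsurj z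
    rw [hd', coaction_homLinear, ← coev_comp]
    exact congrArg (fun b => coev hF.fgp b x) (LinearMap.ext fun y => (hd' y).symm)
  have : IsIso ((coring hF.fgp).comonad.forget.map ψ) := inferInstanceAs (IsIso d.hom)
  have : IsIso ψ := isIso_of_reflects_iso ψ (coring hF.fgp).comonad.forget
  exact ⟨Q, ⟨asIso ψ⟩⟩

/-- The functor `C ⥤ 𝓜^H_fgp` induced by `k`. -/
def fgpComoduleFunctor (hF : IsFGP F) : C ⥤ (coring hF).FGPComodule :=
  ObjectProperty.lift _ (comoduleFunctor hF) hF

instance (hF : IsFGP F) : (fgpComoduleFunctor hF).Additive where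
  map_add := ObjectProperty.hom_ext _ ((comoduleFunctor hF).map_add)

lemma IsFiberFunctor.isEquivalence_fgpComoduleFunctor (hF : IsFiberFunctor F) :
    (fgpComoduleFunctor hF.fgp).IsEquivalence := by
  have := hF.full
  have : (comoduleFunctor hF.fgp).Faithful :=
    ⟨fun e => hF.faithful.map_injective (congrArg Comonad.Coalgebra.Hom.f e)⟩
  have : (fgpComoduleFunctor hF.fgp).Full :=
    Functor.Full.of_comp_faithful_iso (G := ObjectProperty.ι _)
      (Iso.refl (comoduleFunctor hF.fgp))
  have : (fgpComoduleFunctor hF.fgp).Faithful :=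
    Functor.Faithful.of_comp_iso (G := ObjectProperty.ι _) (Iso.refl (comoduleFunctor hF.fgp))
  have : (fgpComoduleFunctor hF.fgp).EssSurj := ⟨fun M => by
    obtain ⟨X, ⟨e⟩⟩ := hF.exists_iso M.obj M.property
    exact ⟨X, ⟨ObjectProperty.isoMk _ e⟩⟩⟩
  exact { }

end Comodules

/-! ### Transfer of comonadicity, monads and coarseness along equivalences -/

section Equivalences

/-- Precomposition of additive presheaves with an additive functor. -/
def precompAdditive {C D : Type*} [Category* C] [Category* D] [Preadditive C] [Preadditive D]
    (e : C ⥤ D) [e.Additive] :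
    (Dᵒᵖ ⥤+ AddCommGrpCat.{u}) ⥤ (Cᵒᵖ ⥤+ AddCommGrpCat.{u}) :=
  ObjectProperty.lift _ (ObjectProperty.ι _ ⋙ (Functor.whiskeringLeft _ _ _).obj e.op) fun V => by
    have : V.obj.Additive := V.property
    exact inferInstanceAs (e.op ⋙ V.obj).Additive

/-- Restriction along `e` is an equivalence on all presheaves. It remains one on additive presheaves
because a presheaf on `D` is additive when its restriction along the full, essentially surjective
additive functor `e` is. -/
lemma isEquivalence_precompAdditive {C D : Type*} [Category* C] [Category* D] [Preadditive C]
    [Preadditive D] (e : C ⥤ D) [e.Additive] [e.IsEquivalence] :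
    (precompAdditive.{u} e).IsEquivalence where
  faithful := Functor.Faithful.of_comp_iso (G := ObjectProperty.ι _)
    (Iso.refl (ObjectProperty.ι _ ⋙ (Functor.whiskeringLeft _ _ _).obj e.op))
  full := Functor.Full.of_comp_faithful_iso (G := ObjectProperty.ι _)
    (Iso.refl (ObjectProperty.ι _ ⋙ (Functor.whiskeringLeft _ _ _).obj e.op))
  essSurj := ⟨fun V => by
    let W := (Functor.whiskeringLeft Cᵒᵖ Dᵒᵖ AddCommGrpCat.{u}).obj e.op
    let i : e.op ⋙ W.objPreimage V.obj ≅ V.obj := W.objObjPreimageIso V.obj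
    have : V.obj.Additive := V.property
    have : (e.op ⋙ W.objPreimage V.obj).Additive := Functor.additive_of_iso i.symm
    exact ⟨⟨W.objPreimage V.obj, Functor.additive_of_full_essSurj_comp e.op _⟩,
      ⟨ObjectProperty.isoMk _ i⟩⟩⟩

/-- A comonadic functor remains comonadic after precomposition with an equivalence. -/
lemma nonempty_comonadicLeftAdjoint_comp {A B D : Type*} [Category.{u} A]
    [Category.{u} B] [Category.{u} D] (K : A ⥤ B) [K.IsEquivalence] (L : B ⥤ D)
    [ComonadicLeftAdjoint L] :
    Nonempty (ComonadicLeftAdjoint (K ⋙ L)) := by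
  -- Beck's criterion: `K` carries a cosplit pair for `K ⋙ L` to one for `L`, whose equalizer `L`
  -- creates; the equivalence `K` creates it in turn.
  have : Comonad.CreatesLimitOfIsCosplitPair (K ⋙ L) := ⟨fun f g h => by
    have : L.IsCosplitPair (K.map f) (K.map g) := h
    let : CreatesLimit (parallelPair ((parallelPair f g ⋙ K).map WalkingParallelPairHom.left)
        ((parallelPair f g ⋙ K).map WalkingParallelPairHom.right)) L :=
      Comonad.createsFSplitEqualizersOfComonadic (F := L) (K.map f) (K.map g)
    let : CreatesLimit (parallelPair f g ⋙ K) L :=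
      createsLimitOfIsoDiagram L (diagramIsoParallelPair (parallelPair f g ⋙ K)).symm
    exact compCreatesLimit K L⟩
  exact ⟨Comonad.comonadicOfCreatesFSplitEqualizers
    (K.asEquivalence.toAdjunction.comp (comonadicAdjunction L))⟩

/-- Up to isomorphism, `L` is an equivalence followed by a faithful forgetful functor from
coalgebras. -/
lemma faithful_of_comonadicLeftAdjoint {A B : Type*} [Category* A] [Category* B] (L : A ⥤ B)
    [ComonadicLeftAdjoint L] : L.Faithful :=
  Functor.Faithful.of_iso (Comonad.comparisonForget (comonadicAdjunction L))

/-- An adjunction with invertible counit is an adjoint equivalence if and only if its monad is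
isomorphic to the identity monad. -/
lemma nonempty_toMonad_iso_id_iff {A B : Type*} [Category* A] [Category* B] {K : A ⥤ B}
    {L : B ⥤ A} (adj : K ⊣ L) [IsIso adj.counit] :
    Nonempty (adj.toMonad ≅ Monad.id A) ↔ K.IsEquivalence := by
  constructor
  · rintro ⟨i⟩
    -- An isomorphism of monads respects units and the identity monad has identity unit, so `i` is
    -- inverse to the unit of the adjunction.
    have h : ∀ X, adj.unit.app X ≫ i.hom.app X = 𝟙 X := fun X => i.hom.app_η X
    have : ∀ X, IsIso (adj.unit.app X) := fun X => by
      have : IsIso (i.hom.app X) := ⟨i.inv.app X,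
        congrArg (fun f : adj.toMonad ⟶ adj.toMonad => f.app X) i.hom_inv_id,
        congrArg (fun f : Monad.id A ⟶ Monad.id A => f.app X) i.inv_hom_id⟩
      exact (isIso_comp_right_iff _ (i.hom.app X)).1 (h X ▸ inferInstanceAs (IsIso (𝟙 X)))
    exact adj.toEquivalence.isEquivalence_functor
  · intro _
    -- The unit is itself the isomorphism of monads; its compatibility with multiplication is the
    -- left unit law.
    let η : 𝟭 A ≅ K ⋙ L := asIso adj.unit
    exact ⟨(MonadIso.mk (M := Monad.id A) (N := adj.toMonad) η
      (fun X => Category.id_comp _) (fun X => by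
        have h : adj.unit.app (L.obj (K.obj X)) ≫ adj.toMonad.μ.app X = 𝟙 _ :=
          adj.toMonad.left_unit X
        exact (Category.id_comp _).trans ((Category.assoc _ _ _).trans
          ((congrArg (adj.unit.app X ≫ ·) h).trans (Category.comp_id _))).symm)).symm⟩

/-- The functor `M ↦ 𝓜^H(-, M)` followed by restriction along the equivalence `C ⥤ 𝓜^H_fgp` is `L`
by definition. Hence it is an equivalence iff `L` is, iff the left adjoint `K` is. -/
lemma isCoarse_iff {C : Type u} [SmallCategory C] [Preadditive C] [HasFiniteBiproducts C]
    {R : Type u} [Ring R] {F : C ⥤ ModuleCat.{u} Rᵐᵒᵖ} [F.Additive] (hF : IsFiberFunctor F) :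
    (coring hF.fgp).IsCoarse ↔ (comparison hF.fgp).IsEquivalence := by
  have := hF.isEquivalence_fgpComoduleFunctor
  have := isEquivalence_precompAdditive.{u} (fgpComoduleFunctor hF.fgp)
  let Φ : (coring hF.fgp).Comodule ⥤ ((coring hF.fgp).FGPComoduleᵒᵖ ⥤+ AddCommGrpCat.{u}) :=
    restrictedYoneda (coring hF.fgp).fgpProperty.ι
  have e : Φ ⋙ precompAdditive.{u} (fgpComoduleFunctor hF.fgp) = comparisonRight hF.fgp := rfl
  have h1 : (coring hF.fgp).IsCoarse ↔ (comparisonRight hF.fgp).IsEquivalence := by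
    rw [← e]
    constructor
    · intro h
      have : Φ.IsEquivalence := h
      infer_instance
    · intro _
      exact Functor.isEquivalence_of_comp_right Φ (precompAdditive.{u} (fgpComoduleFunctor hF.fgp))
  rw [h1]
  constructor
  · intro _
    exact (comparisonAdjunction hF.fgp).isEquivalence_left_of_isEquivalence_right
  · intro _
    exact (comparisonAdjunction hF.fgp).isEquivalence_right_of_isEquivalence_left

end Equivalences

end

end CoarseFiber
-- Equivalence of the seven conditions
open CoarseFiber in
theorem mainTheorem10 {C : Type u} [SmallCategory C] [Preadditive C] [HasFiniteBiproducts C]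
    [IsIdempotentComplete C] {R : Type u} [Ring R] (F : C ⥤ ModuleCat.{u} Rᵐᵒᵖ) [F.Additive]
    (hF : IsFiberFunctor F) :
    List.TFAE [
      ∀ ⦃X Y : C⦄ (t : X ⟶ Y), IsSplitEpi (F.map t) → IsSplitEpi t,
      functorTopology F hF.flat = LinearTopology.coarsest C,
      (comparison hF.fgp).IsEquivalence,
      Nonempty (ComonadicLeftAdjoint (kanExtension F)),
      (kanExtension F).Faithful,
      Nonempty (sheafMonad hF.fgp ≅ Monad.id (Presheaf.{u} C)),
      (coring hF.fgp).IsCoarse] := by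
  have hcounit : ∀ M, IsIso ((comparisonAdjunction hF.fgp).counit.app M) :=
    isIso_counit hF.flat
  have : IsIso (comparisonAdjunction hF.fgp).counit := NatIso.isIso_of_isIso_app _
  tfae_have 1 ↔ 2 :=
    (reflects_isSplitEpi_iff_coversTrivially hF.fgp).trans
      (functorTopology_eq_coarsest_iff hF.flat).symm
  tfae_have 2 → 3 := fun h => by
    have : (kanExtension F).ReflectsIsomorphisms :=
      ((functorTopology_eq_coarsest_iff hF.flat).1 h).reflectsIsomorphisms hF.flat
    have hunit : ∀ U, IsIso ((comparisonAdjunction hF.fgp).unit.app U) := fun U => by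
      -- A triangle identity with invertible counit shows that `K` inverts the unit. The underlying
      -- linear map is its image under the Kan extension, which reflects isomorphisms.
      have h1 : IsIso ((comparison hF.fgp).map ((comparisonAdjunction hF.fgp).unit.app U)) :=
        (isIso_comp_right_iff _ ((comparisonAdjunction hF.fgp).counit.app _)).1 (by
          rw [(comparisonAdjunction hF.fgp).left_triangle_components U]
          exact IsIso.id _)
      have h2 : IsIso ((kanExtension F).map ((comparisonAdjunction hF.fgp).unit.app U)) :=
        inferInstanceAs (IsIso ((coring hF.fgp).comonad.forget.map
          ((comparison hF.fgp).map ((comparisonAdjunction hF.fgp).unit.app U))))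
      exact isIso_of_reflects_iso _ (kanExtension F)
    exact (comparisonAdjunction hF.fgp).toEquivalence.isEquivalence_functor
  tfae_have 3 → 4 := fun _ =>
    nonempty_comonadicLeftAdjoint_comp (comparison hF.fgp) (coring hF.fgp).comonad.forget
  tfae_have 4 → 5 := fun ⟨_⟩ => faithful_of_comonadicLeftAdjoint (kanExtension F)
  tfae_have 5 → 2 := fun _ =>
    (functorTopology_eq_coarsest_iff hF.flat).2 coversTrivially_of_faithful
  tfae_have 6 ↔ 3 := nonempty_toMonad_iso_id_iff (comparisonAdjunction hF.fgp)
  tfae_have 7 ↔ 3 := isCoarse_iff hF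
  tfae_finish
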